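/- Let $n\ge 1$ be an integer. Rings are associative with identity. For a ring $\Lambda$, let $\operatorname{Mod}\Lambda$ be the category of right $\Lambda$-modules, $\operatorname{mod}\Lambda$ and $\operatorname{proj}\Lambda$ its full subcategories of finitely presented and of finitely generated projective modules, and regard left $\Lambda$-modules as $\Lambda^{\mathrm{op}}$-modules. Two rings are Morita equivalent if their categories of right modules are equivalent. Let $\mathcal C$ be an additive and idempotent complete category (locally small, not necessarily small). An $n$-kernel of a morphism $f\colon X\to Y$ of $\mathcal C$ is a sequence $X_n\to\cdots\to X_1\to X$ such that $$0\to\mathcal C(-,X_n)\to\cdots\to\mathcal C(-,X_1)\to\mathcal C(-,X)\xrightarrow{\mathcal C(-,f)}\mathcal C(-,Y)$$ is exact (at every object); $n$-cokernels $Y\to Y_1\to\cdots\to Y_n$ are defined dually. The category $\mathcal C$ is $n$-abelian if - (A1) every morphism has an $n$-kernel; - (A1$^{\mathrm{op}}$) every morphism has an $n$-cokernel; - (A2) for every monomorphism $f\colon X\to Y$ and every $n$-cokernel $Y\xrightarrow{g_1}Y_1\to\cdots\xrightarrow{g_n}Y_n$ of $f$, the sequence $X\xrightarrow{f}Y\xrightarrow{g_1}\cdots\xrightarrow{g_{n-1}}Y_{n-1}$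 is an $n$-kernel of $g_n$; - (A2$^{\mathrm{op}}$) the dual of (A2) holds for every epimorphism and each of its $n$-kernels. An object $X$ of $\mathcal C$ is an additive generator if every object of $\mathcal C$ is a direct summand of a finite direct sum of copies of $X$. A ring $\Lambda$ is right (left) coherent if $\operatorname{mod}\Lambda$ (respectively $\operatorname{mod}\Lambda^{\mathrm{op}}$) is an abelian category. A transpose of $M\in\operatorname{mod}\Lambda$ is a left module $\operatorname{Tr}M=\operatorname{coker}\bigl(\operatorname{Hom}_\Lambda(P_0,\Lambda)\to\operatorname{Hom}_\Lambda(P_1,\Lambda)\bigr)$, where $P_1\to P_0\to M\to 0$ is exact with $P_0,P_1\in\operatorname{proj}\Lambda$. For $\Lambda$ left coherent, $M$ is $n$-torsion free if $\operatorname{Ext}^i(\operatorname{Tr}M,\Lambda)=0$ for $1\le i\le n$, where $\operatorname{Ext}$ is taken in $\operatorname{mod}\Lambda^{\mathrm{op}}$; this does not depend on the choice of $\operatorname{Tr}M$. For left modules the definitions are obtained by exchanging $\Lambda$ and $\Lambda^{\mathrm{op}}$. Consider the axioms - (R1) $\Lambda$ is right coherent and $\operatorname{gl.dim}(\operatorname{mod}\Lambda)\le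 n+1$; - (R1$^{\mathrm{op}}$) $\Lambda$ is left coherent and $\operatorname{gl.dim}(\operatorname{mod}\Lambda^{\mathrm{op}})\le n+1$; - (R2) every $M\in\operatorname{mod}\Lambda$ with $\operatorname{pd}M\le 1$ is $n$-torsion free; - (R2$^{\mathrm{op}}$) every $M\in\operatorname{mod}\Lambda^{\mathrm{op}}$ with $\operatorname{pd}M\le 1$ is $n$-torsion free. **Theorem.** There is a bijective correspondence between the equivalence classes of $n$-abelian categories with additive generators and the Morita equivalence classes of rings satisfying (R1), (R1$^{\mathrm{op}}$), (R2) and (R2$^{\mathrm{op}}$). It is given as follows: (a) the class of an $n$-abelian category $\mathcal C$ with an additive generator is sent to the class of the ring $\operatorname{End}(X)$, where $X$ is any additive generator of $\mathcal C$; (b) in the inverse direction, the class of a ring $\Lambda$ satisfying (R1), (R1$^{\mathrm{op}}$), (R2) and (R2$^{\mathrm{op}}$) is sent to the class of the category $\operatorname{proj}\Lambda$. In particular, the rings $\operatorname{End}(X)$ in (a) satisfy these axioms, and the categories $\operatorname{proj}\Lambda$ in (b) are $n$-abelian and have an additive generator. -/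

import Mathlib

open CategoryTheory CategoryTheory.Limits

universe u v

/-! ### `n`-abelian categories -/

namespace NAb

section Sequences

variable {C : Type u} [Category.{v} C] [Preadditive C]

/-- For a sequence `S₀ ⟶ S₁ ⟶ ⋯ ⟶ S_{n+1}` of morphisms: the sequence of representable functors
`0 ⟶ C(-, S₀) ⟶ C(-, S₁) ⟶ ⋯ ⟶ C(-, S_{n+1})` is exact, i.e. exact after evaluation at every
object `Z`. In other words `S₀ ⟶ ⋯ ⟶ Sₙ` is an `n`-kernel of `Sₙ ⟶ S_{n+1}`. -/
structure IsNKernelSeq {n : ℕ} (S : ComposableArrows C (n + 1)) : Prop where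
  injective : ∀ (Z : C) (h : Z ⟶ S.obj' 0), h ≫ S.map' 0 1 = 0 → h = 0
  exact : ∀ (i : ℕ) (hi : i + 2 ≤ n + 1) (Z : C) (h : Z ⟶ S.obj' (i + 1)),
    h ≫ S.map' (i + 1) (i + 2) = 0 ↔ ∃ k : Z ⟶ S.obj' i, k ≫ S.map' i (i + 1) = h

/-- For a sequence `S₀ ⟶ S₁ ⟶ ⋯ ⟶ S_{n+1}` of morphisms: the sequence of representable functors
`0 ⟶ C(S_{n+1}, -) ⟶ ⋯ ⟶ C(S₁, -) ⟶ C(S₀, -)` is exact, i.e. exact after evaluation at every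
object `Z`. In other words `S₁ ⟶ ⋯ ⟶ S_{n+1}` is an `n`-cokernel of `S₀ ⟶ S₁`. -/
structure IsNCokernelSeq {n : ℕ} (S : ComposableArrows C (n + 1)) : Prop where
  injective : ∀ (Z : C) (h : S.obj' (n + 1) ⟶ Z), S.map' n (n + 1) ≫ h = 0 → h = 0
  exact : ∀ (i : ℕ) (hi : i + 2 ≤ n + 1) (Z : C) (h : S.obj' (i + 1) ⟶ Z),
    S.map' i (i + 1) ≫ h = 0 ↔ ∃ k : S.obj' (i + 2) ⟶ Z, S.map' (i + 1) (i + 2) ≫ k = h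

/-- `f` has an `n`-kernel. (The last morphism of the sequence is identified with `f` through an
isomorphism of arrows, which avoids equalities of objects.) -/
def HasNKernel (n : ℕ) {X Y : C} (f : X ⟶ Y) : Prop :=
  ∃ S : ComposableArrows C (n + 1),
    Nonempty (Arrow.mk (S.map' n (n + 1)) ≅ Arrow.mk f) ∧ IsNKernelSeq S

/-- `f` has an `n`-cokernel. -/
def HasNCokernel (n : ℕ) {X Y : C} (f : X ⟶ Y) : Prop :=
  ∃ S : ComposableArrows C (n + 1),
    Nonempty (Arrow.mk (S.map' 0 1) ≅ Arrow.mk f) ∧ IsNCokernelSeq S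

end Sequences

/-- An `n`-abelian category (`n ≥ 1`): an additive and idempotent complete category satisfying the
axioms (A1), (A1ᵒᵖ), (A2) and (A2ᵒᵖ). -/
structure IsNAbelian (n : ℕ) (C : Type u) [Category.{v} C] [Preadditive C] : Prop where
  hasFiniteBiproducts : HasFiniteBiproducts C
  isIdempotentComplete : IsIdempotentComplete C
  /-- (A1): every morphism has an `n`-kernel. -/
  a1 : ∀ ⦃X Y : C⦄ (f : X ⟶ Y), HasNKernel n f
  /-- (A1ᵒᵖ): every morphism has an `n`-cokernel. -/
  a1_op : ∀ ⦃X Y : C⦄ (f : X ⟶ Y), HasNCokernel n f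
  /-- (A2): every monomorphism `S₀ ⟶ S₁` together with any of its `n`-cokernels
  `S₁ ⟶ ⋯ ⟶ S_{n+1}` gives an `n`-kernel `S₀ ⟶ ⋯ ⟶ Sₙ` of `Sₙ ⟶ S_{n+1}`. -/
  a2 : ∀ S : ComposableArrows C (n + 1),
    Mono (S.map' 0 1) → IsNCokernelSeq S → IsNKernelSeq S
  /-- (A2ᵒᵖ): every epimorphism `Sₙ ⟶ S_{n+1}` together with any of its `n`-kernels
  `S₀ ⟶ ⋯ ⟶ Sₙ` gives an `n`-cokernel `S₁ ⟶ ⋯ ⟶ S_{n+1}` of `S₀ ⟶ S₁`. -/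
  a2_op : ∀ S : ComposableArrows C (n + 1),
    Epi (S.map' n (n + 1)) → IsNKernelSeq S → IsNCokernelSeq S

/-- `X` is an additive generator: every object is a direct summand (equivalently, in an idempotent
complete category, a retract) of a finite direct sum of copies of `X`. -/
def IsAdditiveGenerator {C : Type u} [Category.{v} C] [Preadditive C] (X : C) : Prop :=
  ∀ Y : C, ∃ (k : ℕ) (b : Bicone (fun _ : Fin k => X)),
    Nonempty b.IsBilimit ∧ Nonempty (Retract Y b.pt)

/-! ### Modules over a ring

Everything is phrased for left modules over a ring `R`. Right modules over `Λ` are modules over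
`Λᵐᵒᵖ`; so `mod Λ` is `FPMod Λᵐᵒᵖ`, `mod Λᵒᵖ` is `FPMod Λ` and `proj Λ` is `FGProj Λᵐᵒᵖ`. -/

/-- The category of finitely presented (left) `R`-modules. -/
abbrev FPMod (R : Type v) [Ring R] : Type (v + 1) :=
  ObjectProperty.FullSubcategory
    (fun M : ModuleCat.{v} R => Module.FinitePresentation R M)

/-- The category of finitely generated projective (left) `R`-modules. -/
abbrev FGProj (R : Type v) [Ring R] : Type (v + 1) :=
  ObjectProperty.FullSubcategory
    (fun P : ModuleCat.{v} R => Module.Finite R P ∧ Module.Projective R P)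

/-- The global dimension of the abelian category `A` is at most `d`. -/
def GlobalDimensionLE (A : Type u) [Category.{v} A] [Abelian A] (d : ℕ) : Prop :=
  ∀ M : A, HasProjectiveDimensionLE M d

section Transpose

variable {R S : Type v} [Ring R] [Ring S]

/-- Let `B` be an `R`-`S`-bimodule (with commuting actions). The `S`-module `N` is a transpose,
with respect to `B`, of the `R`-module `M`: there is a morphism `f : P₁ ⟶ P₀` of
finitely generated projective `R`-modules with `M ≅ coker f` and
`N ≅ coker (f* : Hom_R(P₀, B) ⟶ Hom_R(P₁, B))`.
We use it for `B = Λ`, with `(R, S) = (Λᵐᵒᵖ, Λ)` or `(R, S) = (Λ, Λᵐᵒᵖ)`. -/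
def IsTranspose (B : Type v) [AddCommGroup B] [Module R B] [Module S B] [SMulCommClass R S B]
    (M : FPMod R) (N : FPMod S) : Prop :=
  ∃ (P₁ P₀ : FGProj R) (f : P₁.obj →ₗ[R] P₀.obj),
    Nonempty ((P₀.obj ⧸ LinearMap.range f) ≃ₗ[R] M.obj) ∧
    Nonempty (((P₁.obj →ₗ[R] B) ⧸ LinearMap.range (LinearMap.lcomp S B f)) ≃ₗ[S] N.obj)

/-- `M` is `k`-torsion free: `Extⁱ(Tr M, B) = 0` for `1 ≤ i ≤ k`, for the transposes `Tr M` of `M`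
(any two of them are isomorphic up to projective direct summands). The groups `Ext` are those
of the abelian category of finitely presented `S`-modules. -/
def IsTorsionFree (B : Type v) [AddCommGroup B] [Module R B] [Module S B] [SMulCommClass R S B]
    [hB : Module.FinitePresentation S B] [Abelian (FPMod S)] (k : ℕ) (M : FPMod R) : Prop :=
  letI := HasExt.standard (FPMod S)
  ∀ N : FPMod S, IsTranspose B M N → ∀ i : ℕ, 1 ≤ i → i ≤ k →
    Subsingleton (Abelian.Ext.{v + 1} N (⟨ModuleCat.of S B, hB⟩ : FPMod S) i)

end Transpose

/-- `Λ` is finitely presented as a right module over itself. -/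
instance finitePresentation_mulOpposite_self (Λ : Type v) [Ring Λ] :
    Module.FinitePresentation Λᵐᵒᵖ Λ :=
  Module.finitePresentation_of_surjective
    (MulOpposite.opLinearEquiv Λᵐᵒᵖ : Λ ≃ₗ[Λᵐᵒᵖ] Λᵐᵒᵖ).symm.toLinearMap
    (MulOpposite.opLinearEquiv Λᵐᵒᵖ : Λ ≃ₗ[Λᵐᵒᵖ] Λᵐᵒᵖ).symm.surjective
    (by simp [LinearEquiv.ker, Submodule.fg_bot])

/-- The ring `Λ` satisfies the axioms (R1), (R1ᵒᵖ), (R2) and (R2ᵒᵖ):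
`Λ` is right and left coherent, i.e. `mod Λ` and `mod Λᵒᵖ` are abelian categories (an abelian
structure on a category is unique), and, in these abelian categories,
* `gldim (mod Λ) ≤ n + 1`;
* `gldim (mod Λᵒᵖ) ≤ n + 1`;
* every `M` in `mod Λ` with `pdim M ≤ 1` is `n`-torsion free;
* every `M` in `mod Λᵒᵖ` with `pdim M ≤ 1` is `n`-torsion free. -/
def SatisfiesR (n : ℕ) (Λ : Type v) [Ring Λ] : Prop :=
  ∃ (_ : Abelian (FPMod Λᵐᵒᵖ)) (_ : Abelian (FPMod Λ)),
    GlobalDimensionLE (FPMod Λᵐᵒᵖ) (n + 1) ∧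
    GlobalDimensionLE (FPMod Λ) (n + 1) ∧
    (∀ M : FPMod Λᵐᵒᵖ, HasProjectiveDimensionLE M 1 → IsTorsionFree (S := Λ) Λ n M) ∧
    (∀ M : FPMod Λ, HasProjectiveDimensionLE M 1 → IsTorsionFree (S := Λᵐᵒᵖ) Λ n M)

/-! ### The two collections of equivalence classes -/

/-- An `n`-abelian category with an additive generator (with a class of objects and with
morphism sets in the universe `v`). -/
structure NAbelianCat (n : ℕ) : Type (v + 2) where
  carrier : Type (v + 1)
  [category : Category.{v} carrier]
  [preadditive : Preadditive carrier]
  isNAbelian : IsNAbelian n carrier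
  hasAdditiveGenerator : ∃ X : carrier, IsAdditiveGenerator X

attribute [instance] NAbelianCat.category NAbelianCat.preadditive

/-- A ring satisfying (R1), (R1ᵒᵖ), (R2), (R2ᵒᵖ). -/
structure RRing (n : ℕ) : Type (v + 1) where
  carrier : Type v
  [ring : Ring carrier]
  satisfiesR : SatisfiesR n carrier

attribute [instance] RRing.ring

/-- Equivalence of categories, on `n`-abelian categories with an additive generator. -/
instance NAbelianCat.setoid (n : ℕ) : Setoid (NAbelianCat.{v} n) where
  r C D := Nonempty (C.carrier ≌ D.carrier)
  iseqv :=
    { refl := fun _ => ⟨CategoryTheory.Equivalence.refl⟩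
      symm := fun ⟨e⟩ => ⟨e.symm⟩
      trans := fun ⟨e⟩ ⟨e'⟩ => ⟨e.trans e'⟩ }

/-- Morita equivalence of rings: their categories of right modules are equivalent
(as additive categories). -/
instance RRing.setoid (n : ℕ) : Setoid (RRing.{v} n) where
  r Λ Γ := IsMoritaEquivalent ℤ Λ.carrierᵐᵒᵖ Γ.carrierᵐᵒᵖ
  iseqv :=
    { refl := fun Λ => IsMoritaEquivalent.refl ℤ Λ.carrierᵐᵒᵖ
      symm := fun h => h.symm ℤ
      trans := fun h h' => h.trans ℤ h' }

/-- Equivalence classes of `n`-abelian categories with an additive generator. -/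
abbrev NAbelianClasses (n : ℕ) : Type (v + 2) := Quotient (NAbelianCat.setoid.{v} n)

/-- Morita equivalence classes of rings satisfying (R1), (R1ᵒᵖ), (R2), (R2ᵒᵖ). -/
abbrev MoritaClasses (n : ℕ) : Type (v + 1) := Quotient (RRing.setoid.{v} n)

end NAb

/-! Everything is reduced to the categories of projective modules. If `X` is an additive generator
of `C`, every identity is a finite sum of morphisms factoring through `X` (`IsGeneratedBy`), and
idempotents split, so `Hom(X, -)` is an equivalence from `C` to the finitely generated projective
right `End X`-modules (`homFunctor`). It remains to see that `proj Λ` is `n`-abelian if and only if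
`Λ` satisfies the four axioms (`SatisfiesR.isNAbelian`, `satisfiesR_of_isNAbelian`). The duality
`Hom(-, Λ)` identifies the opposite of `proj Λ` with the projectives on the other side
(`dualFunctor`), so each axiom and its dual can be treated by one argument.

(A1) corresponds to (R1). Weak kernels in `proj Λ` are exact sequences of modules, so an `n`-kernel
of `f` is a projective resolution of `ker f` of length at most `n - 1`. Every finitely presented
module is the cokernel of some `f`, with `ker f` as second syzygy. Hence all `n`-kernels exist
exactly when `Λ` is coherent and the global dimension is at most `n + 1`.

(A2) corresponds to (R2). A monomorphism `f` between projectives presents a module of projective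
dimension at most 1. Dualizing an `n`-cokernel of `f` gives the beginning of a projective resolution
of the transpose `coker f*`; dualizing again gives back the original sequence. So `Ext^1, …, Ext^n`
of the transpose vanish exactly when that sequence is an `n`-kernel (`IsNCokernelSeq.ext_iff`).

For the classes, modules over `End X` are the additive presheaves on `C`, whatever the generator `X`
(`isMoritaEquivalent_end`). Conversely an equivalence of module categories preserves finitely
generated projectives, finite generation being a property of the lattice of subobjects. -/

namespace NAb

/-! ### Short exact sequences, projective dimension and Ext -/

section ShortExact

universe w

variable {D : Type u} [Category.{v} D]

/-- The morphism factors through a zero object. This notion does not refer to a choice of zero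
morphisms. -/
def FactorsThroughZero {X Y : D} (f : X ⟶ Y) : Prop :=
  ∃ (Z : D) (a : X ⟶ Z) (b : Z ⟶ Y), IsZero Z ∧ f = a ≫ b

/-- The abelian structure on `FPMod R` is an arbitrary one, whose zero morphisms are not by
definition the zero linear maps. Factoring through a zero object makes sense for both, so exactness
checked on modules can be used in the given abelian structure. -/
lemma factorsThroughZero_iff [HasZeroMorphisms D] [HasZeroObject D] {X Y : D} (f : X ⟶ Y) :
    FactorsThroughZero f ↔ f = 0 := by
  constructor
  · rintro ⟨Z, a, b, hZ, rfl⟩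
    rw [hZ.eq_zero_of_tgt a, zero_comp]
  · rintro rfl
    exact ⟨_, 0, 0, isZero_zero D, by simp⟩

/-- `0 ⟶ X ⟶ Y ⟶ Z ⟶ 0` is a short exact sequence; no choice of zero morphisms is involved. -/
structure IsShortExact {X Y Z : D} (f : X ⟶ Y) (g : Y ⟶ Z) : Prop where
  mono : Mono f
  epi : Epi g
  zero : FactorsThroughZero (f ≫ g)
  lift : ∀ (W : D) (k : W ⟶ Y), FactorsThroughZero (k ≫ g) → ∃ l : W ⟶ X, l ≫ f = k

variable [Abelian D] {X Y Z : D} {f : X ⟶ Y} {g : Y ⟶ Z}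

lemma IsShortExact.comp_eq_zero (h : IsShortExact f g) : f ≫ g = 0 :=
  (factorsThroughZero_iff _).1 h.zero

lemma IsShortExact.shortExact (h : IsShortExact f g) :
    (ShortComplex.mk f g h.comp_eq_zero).ShortExact := by
  have := h.mono
  have := h.epi
  have hl : ∀ (W : D) (k : W ⟶ Y), k ≫ g = 0 → ∃ l : W ⟶ X, l ≫ f = k := fun W k hk =>
    h.lift W k ((factorsThroughZero_iff _).2 hk)
  refine { exact := ShortComplex.exact_of_f_is_kernel _ ?_, mono_f := ‹_›, epi_g := ‹_› }
  exact KernelFork.IsLimit.ofι' _ _ fun {W} k hk => ⟨(hl W k hk).choose, (hl W k hk).choose_spec⟩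

lemma IsShortExact.hasProjectiveDimensionLT_right (h : IsShortExact f g) (n : ℕ)
    (h₁ : HasProjectiveDimensionLT X n) (h₂ : HasProjectiveDimensionLT Y (n + 1)) :
    HasProjectiveDimensionLT Z (n + 1) :=
  h.shortExact.hasProjectiveDimensionLT_X₃ n h₁ h₂

lemma IsShortExact.hasProjectiveDimensionLT_left (h : IsShortExact f g) (n : ℕ)
    (h₁ : HasProjectiveDimensionLT Y n) (h₂ : HasProjectiveDimensionLT Z (n + 1)) :
    HasProjectiveDimensionLT X n :=
  h.shortExact.hasProjectiveDimensionLT_X₁ n h₁ h₂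

open Abelian in
-- As `Y` is projective, the long exact sequence ends in `Hom(Y, B) → Hom(X, B) → Ext^1(Z, B) → 0`.
lemma IsShortExact.subsingleton_ext_one_iff [HasExt.{w} D] (h : IsShortExact f g) [Projective Y]
    (B : D) : Subsingleton (Ext Z B 1) ↔ ∀ φ : X ⟶ B, ∃ ψ : Y ⟶ B, f ≫ ψ = φ := by
  constructor
  · intro hs φ
    obtain ⟨x, hx⟩ := Ext.contravariant_sequence_exact₁ h.shortExact B (Ext.mk₀ φ) (add_zero 1)
      (Subsingleton.elim _ _)
    obtain ⟨ψ, rfl⟩ := (Ext.mk₀_bijective _ _).2 x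
    refine ⟨ψ, (Ext.mk₀_bijective _ _).1 ?_⟩
    rw [← hx]
    simp
  · intro hφ
    refine ⟨fun a b => ?_⟩
    have key : ∀ x : Ext Z B 1, x = 0 := by
      intro x
      obtain ⟨y, rfl⟩ := Ext.contravariant_sequence_exact₃ h.shortExact B x
        (Ext.eq_zero_of_projective _) (add_zero 1)
      obtain ⟨φ, rfl⟩ := (Ext.mk₀_bijective _ _).2 y
      obtain ⟨ψ, rfl⟩ := hφ φ
      rw [← Ext.mk₀_comp_mk₀, ← Ext.comp_assoc _ _ _ (add_zero 1) (add_zero 0) (by omega)]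
      have := h.shortExact.extClass_comp
      dsimp only at this
      rw [this, Ext.zero_comp]
    rw [key a, key b]

open Abelian in
-- Dimension shifting: the positive Ext groups of the middle term vanish.
lemma IsShortExact.subsingleton_ext_succ_iff [HasExt.{w} D] (h : IsShortExact f g) [Projective Y]
    (B : D) (i : ℕ) : Subsingleton (Ext Z B (i + 2)) ↔ Subsingleton (Ext X B (i + 1)) := by
  constructor
  · refine fun hs => ⟨fun a b => ?_⟩
    have key : ∀ x : Ext X B (i + 1), x = 0 := by
      intro x
      obtain ⟨y, rfl⟩ := Ext.contravariant_sequence_exact₁ h.shortExact B x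
        (show 1 + (i + 1) = i + 2 by omega) (Subsingleton.elim _ _)
      rw [Ext.eq_zero_of_projective y, Ext.comp_zero]
    rw [key a, key b]
  · refine fun hs => ⟨fun a b => ?_⟩
    have key : ∀ x : Ext Z B (i + 2), x = 0 := by
      intro x
      obtain ⟨y, rfl⟩ := Ext.contravariant_sequence_exact₃ h.shortExact B x
        (Ext.eq_zero_of_projective _) (show 1 + (i + 1) = i + 2 by omega)
      rw [Subsingleton.elim y 0, Ext.comp_zero]
    rw [key a, key b]

lemma exists_kernel (g : Y ⟶ Z) : ∃ (X : D) (f : X ⟶ Y), Mono f ∧ FactorsThroughZero (f ≫ g) ∧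
    ∀ (W : D) (k : W ⟶ Y), FactorsThroughZero (k ≫ g) → ∃ l : W ⟶ X, l ≫ f = k := by
  refine ⟨kernel g, kernel.ι g, inferInstance, (factorsThroughZero_iff _).2 (kernel.condition g),
    fun W k hk => ⟨kernel.lift g k ((factorsThroughZero_iff _).1 hk), kernel.lift_ι _ _ _⟩⟩

end ShortExact

/-! ### Finitely presented modules: coherence as closure under kernels -/

variable (R : Type v) [Ring R]

/-- Kernels of linear maps between finitely presented modules are finitely presented. -/
def HasFPKernels : Prop :=
  ∀ ⦃M N : Type v⦄ [AddCommGroup M] [Module R M] [AddCommGroup N] [Module R N]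
    (f : M →ₗ[R] N), Module.FinitePresentation R M → Module.FinitePresentation R N →
      Module.FinitePresentation R (LinearMap.ker f)

variable {R}

/-- The object of `FPMod R` given by a finitely presented module. -/
abbrev fp (M : Type v) [AddCommGroup M] [Module R M] [h : Module.FinitePresentation R M] :
    FPMod R := ⟨ModuleCat.of R M, h⟩

/-- The morphism of `FPMod R` given by a linear map. -/
abbrev fpHom {M N : FPMod R} (f : M.obj →ₗ[R] N.obj) : M ⟶ N :=
  ObjectProperty.homMk (ModuleCat.ofHom f)

instance (M : FPMod R) : Module.FinitePresentation R M.obj := M.property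

lemma finitePresentation_quotient_range {M N : Type*} [AddCommGroup M] [Module R M]
    [AddCommGroup N] [Module R N] [Module.Finite R M] [Module.FinitePresentation R N]
    (f : M →ₗ[R] N) : Module.FinitePresentation R (N ⧸ LinearMap.range f) :=
  Module.finitePresentation_of_surjective (Submodule.mkQ _) (Submodule.mkQ_surjective _) (by
    rw [Submodule.ker_mkQ, LinearMap.range_eq_map]
    exact (Module.Finite.fg_top).map _)

lemma FPMod.injective_of_mono {M N : FPMod R} (f : M ⟶ N) [Mono f] :
    Function.Injective f.hom.hom := by
  rw [← LinearMap.ker_eq_bot, LinearMap.ker_eq_bot']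
  intro x hx
  have : fpHom (M := fp R) (N := M)
      (LinearMap.toSpanSingleton R M.obj x) = 
      fpHom 0 := by
    rw [← cancel_mono f]
    ext
    simp [hx]
  have h2 := congrArg (fun g => g.hom.hom (1 : R)) this
  simpa using h2

lemma FPMod.mono_of_injective {M N : FPMod R} (f : M ⟶ N)
    (h : Function.Injective f.hom.hom) : Mono f := by
  have : Mono f.hom := (ModuleCat.mono_iff_injective _).2 h
  exact (ObjectProperty.ι _).mono_of_mono_map this

/-- The quotient by the range is again finitely presented, so it is available as a test object. -/
lemma FPMod.surjective_of_epi {M N : FPMod R} (f : M ⟶ N) [Epi f] :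
    Function.Surjective f.hom.hom := by
  rw [← LinearMap.range_eq_top]
  have : Module.FinitePresentation R (N.obj ⧸ LinearMap.range f.hom.hom) :=
    finitePresentation_quotient_range _
  have h2 : fpHom (M := N) (N := fp (N.obj ⧸ LinearMap.range f.hom.hom)) (Submodule.mkQ _) =
      fpHom 0 := by
    rw [← cancel_epi f]
    ext y
    simp
  have h3 := congrArg (fun g => g.hom.hom) h2
  simp only [ObjectProperty.homMk_hom, ModuleCat.hom_ofHom] at h3
  rw [← Submodule.ker_mkQ (LinearMap.range f.hom.hom), h3, LinearMap.ker_zero]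

lemma FPMod.epi_of_surjective {M N : FPMod R} (f : M ⟶ N)
    (h : Function.Surjective f.hom.hom) : Epi f := by
  have : Epi f.hom := (ModuleCat.epi_iff_surjective _).2 h
  exact (ObjectProperty.ι _).epi_of_epi_map this

lemma FPMod.factorsThroughZero_iff {M N : FPMod R} (f : M ⟶ N) :
    FactorsThroughZero f ↔ f.hom.hom = 0 := by
  constructor
  · rintro ⟨Z, a, b, hZ, rfl⟩
    have : a = fpHom 0 := hZ.eq_of_tgt _ _
    rw [this]
    ext x
    exact map_zero b.hom.hom
  · intro h
    refine ⟨fp PUnit.{v + 1}, fpHom 0, fpHom 0, ?_, ?_⟩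
    · have : IsZero (ModuleCat.of R PUnit.{v + 1}) := ModuleCat.isZero_of_subsingleton _
      exact ⟨fun X => ⟨⟨⟨fpHom 0⟩, fun _ => ObjectProperty.hom_ext _ (this.eq_of_src _ _)⟩⟩,
        fun X => ⟨⟨⟨fpHom 0⟩, fun _ => ObjectProperty.hom_ext _ (this.eq_of_tgt _ _)⟩⟩⟩
    · ext x
      exact congrArg (fun k => k x) h

lemma FPMod.isShortExact {M N K : FPMod R} (f : M ⟶ N) (g : N ⟶ K)
    (hf : Function.Injective f.hom.hom) (hfg : Function.Exact f.hom.hom g.hom.hom)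
    (hg : Function.Surjective g.hom.hom) : IsShortExact f g where
  mono := FPMod.mono_of_injective f hf
  epi := FPMod.epi_of_surjective g hg
  zero := (FPMod.factorsThroughZero_iff _).2 hfg.linearMap_comp_eq_zero
  lift W k hk := by
    rw [FPMod.factorsThroughZero_iff] at hk
    have h : ∀ w, k.hom.hom w ∈ LinearMap.range f.hom.hom := fun w =>
      (hfg _).1 (LinearMap.congr_fun hk w)
    refine ⟨fpHom ((LinearEquiv.ofInjective _ hf).symm.toLinearMap ∘ₗ
      LinearMap.codRestrict _ k.hom.hom h), ?_⟩
    ext w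
    exact congrArg Subtype.val
      ((LinearEquiv.ofInjective _ hf).apply_symm_apply (LinearMap.codRestrict _ k.hom.hom h w))

/-- Testing the categorical kernel against the object `R` shows that it has the same elements as the
kernel of the linear map. -/
lemma hasFPKernels_of_abelian [Abelian (FPMod R)] : HasFPKernels R := by
  intro M N _ _ _ _ f hM hN
  obtain ⟨K, i, hi, hz, hl⟩ := exists_kernel (fpHom f : fp (R := R) M ⟶ fp N)
  rw [FPMod.factorsThroughZero_iff] at hz
  have hinj := FPMod.injective_of_mono i
  let φ : K.obj →ₗ[R] LinearMap.ker f :=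
    LinearMap.codRestrict _ i.hom.hom (fun y => LinearMap.congr_fun hz y)
  have hφ : Function.Bijective φ := by
    constructor
    · intro a b hab
      exact hinj (congrArg Subtype.val hab)
    · rintro ⟨x, hx⟩
      obtain ⟨l, hl⟩ := hl (fp R) (fpHom (LinearMap.toSpanSingleton R M x)) (by
        rw [FPMod.factorsThroughZero_iff]
        ext
        have hx' : f x = 0 := hx
        change f ((1 : R) • x) = 0
        rw [map_smul, hx', smul_zero])
      refine ⟨l.hom.hom (1 : R), Subtype.ext ?_⟩
      have := congrArg (fun q => q.hom.hom (1 : R)) hl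
      refine this.trans ?_
      change (1 : R) • x = x
      simp
  exact Module.FinitePresentation.of_equiv (LinearEquiv.ofBijective φ hφ)

lemma isClosedUnderFiniteProducts_of_pi (P : ObjectProperty (ModuleCat.{v} R))
    [P.IsClosedUnderIsomorphisms]
    (h : ∀ (J : Type v) [Finite J] (M : J → ModuleCat.{v} R), (∀ j, P (M j)) →
      P (ModuleCat.of R (∀ j, M j))) : P.IsClosedUnderFiniteProducts := by
  refine ObjectProperty.IsClosedUnderFiniteProducts.of_isClosedUnderLimitsOfShape.{v}
    fun J _ => ⟨?_⟩
  rintro X ⟨p, hp⟩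
  refine P.prop_of_iso ?_ (h J (fun j => p.diag.obj ⟨j⟩) (fun j => hp ⟨j⟩))
  exact (ModuleCat.HasLimit.productLimitCone (fun j => p.diag.obj ⟨j⟩)).isLimit.conePointsIsoOfNatIso
    p.isLimit Discrete.natIsoFunctor.symm

lemma abelian_of_hasFPKernels (h : HasFPKernels R) : Nonempty (Abelian (FPMod R)) := by
  let P : ObjectProperty (ModuleCat.{v} R) := fun M => Module.FinitePresentation R M
  have : P.IsClosedUnderIsomorphisms := ⟨fun e hX =>
    have : Module.FinitePresentation R _ := hX
    Module.FinitePresentation.of_equiv e.toLinearEquiv⟩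
  have : P.ContainsZero := ⟨⟨ModuleCat.of R PUnit.{v+1}, ModuleCat.isZero_of_subsingleton _,
    (inferInstance : Module.FinitePresentation R PUnit.{v+1})⟩⟩
  have : P.IsClosedUnderKernels := by
    constructor
    rintro _ ⟨f, k, hk, hX, hY⟩
    have := h f.hom hX hY
    have e := hk.conePointUniqueUpToIso (ModuleCat.kernelIsLimit f)
    exact P.prop_of_iso e.symm this
  have : P.IsClosedUnderCokernels := by
    constructor
    rintro _ @⟨X, Y, f, k, hk, hX, hY⟩
    have e := hk.coconePointUniqueUpToIso (ModuleCat.cokernelIsColimit f)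
    refine P.prop_of_iso e.symm ?_
    have : Module.FinitePresentation R X := hX
    have : Module.FinitePresentation R Y := hY
    exact finitePresentation_quotient_range f.hom
  have : P.IsClosedUnderFiniteProducts := isClosedUnderFiniteProducts_of_pi P
    (fun J _ M hM => by
      have := Fintype.ofFinite J
      have : ∀ j, Module.FinitePresentation R (M j) := hM
      exact (inferInstance : Module.FinitePresentation R (∀ j, M j)))
  exact ⟨(inferInstance : Abelian P.FullSubcategory)⟩

end NAb

namespace NAb

lemma exists_iso_of_arrow_iso {C : Type u} [Category.{v} C] {X Y X' Y' : C}
    {f : X ⟶ Y} {f' : X' ⟶ Y'}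
    (e : Arrow.mk f ≅ Arrow.mk f') :
    ∃ (e₁ : X ≅ X') (e₂ : Y ≅ Y'), e₁.hom ≫ f' = f ≫ e₂.hom :=
  ⟨Arrow.leftFunc.mapIso e, Arrow.rightFunc.mapIso e, e.hom.w⟩

lemma arrow_eq_of_val_eq {C : Type u} [Category.{v} C] {m : ℕ} (S : ComposableArrows C m)
    {a b a' b' : Fin (m + 1)}
    (ha : (a : ℕ) = a') (hb : (b : ℕ) = b') (h : a ≤ b) (h' : a' ≤ b') :
    Arrow.mk (S.map (homOfLE h)) = Arrow.mk (S.map (homOfLE h')) := by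
  obtain rfl := Fin.ext ha
  obtain rfl := Fin.ext hb
  rfl

/-- Isomorphisms of arrows yield isomorphisms of the opposite arrows. -/
def arrowOpIso {C : Type u} [Category.{v} C] {X Y X' Y' : C} {f : X ⟶ Y} {f' : X' ⟶ Y'}
    (e : Arrow.mk f ≅ Arrow.mk f') : Arrow.mk f.op ≅ Arrow.mk f'.op :=
  Arrow.isoMk (Arrow.rightFunc.mapIso e.symm).op (Arrow.leftFunc.mapIso e.symm).op
    (Quiver.Hom.unop_inj e.inv.w.symm)

/-- Isomorphisms of arrows in the opposite category yield isomorphisms of the unopped arrows. -/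
def arrowUnopIso {C : Type u} [Category.{v} C] {X Y X' Y' : Cᵒᵖ} {f : X ⟶ Y} {f' : X' ⟶ Y'}
    (e : Arrow.mk f ≅ Arrow.mk f') : Arrow.mk f.unop ≅ Arrow.mk f'.unop :=
  Arrow.isoMk (Arrow.rightFunc.mapIso e.symm).unop (Arrow.leftFunc.mapIso e.symm).unop
    (Quiver.Hom.op_inj e.inv.w.symm)

/-! ### Reversing sequences -/

section Sequences

variable {C : Type u} [Category.{v} C] [Preadditive C]

/-- Indices are arbitrary elements of `Fin (n + 2)` constrained only through their values; this lets
`Fin.rev` be substituted without transporting along equalities of objects. -/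
lemma isNKernelSeq_iff {n : ℕ} (S : ComposableArrows C (n + 1)) :
    IsNKernelSeq S ↔
      (∀ (a b : Fin (n + 2)) (_ : (a : ℕ) = 0) (_ : (b : ℕ) = 1) (hab : a ≤ b) (Z : C)
        (h : Z ⟶ S.obj a), h ≫ S.map (homOfLE hab) = 0 → h = 0) ∧
      (∀ (a b c : Fin (n + 2)) (_ : (b : ℕ) = a + 1) (_ : (c : ℕ) = b + 1) (hab : a ≤ b)
        (hbc : b ≤ c) (Z : C) (h : Z ⟶ S.obj b),
        h ≫ S.map (homOfLE hbc) = 0 ↔ ∃ k : Z ⟶ S.obj a, k ≫ S.map (homOfLE hab) = h) := by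
  constructor
  · intro hS
    constructor
    · rintro ⟨a, ha⟩ ⟨b, hb⟩ h1 h2 hab Z h
      dsimp only at h1 h2
      subst h1 h2
      exact hS.injective Z h
    · rintro ⟨a, ha⟩ ⟨b, hb⟩ ⟨c, hc⟩ h1 h2 hab hbc Z h
      dsimp only at h1 h2
      subst h1 h2
      exact hS.exact a (by omega) Z h
  · rintro ⟨h1, h2⟩
    exact ⟨fun Z h => h1 _ _ rfl rfl _ Z h, fun i hi Z h => h2 _ _ _ rfl rfl _ _ Z h⟩

lemma isNCokernelSeq_iff {n : ℕ} (S : ComposableArrows C (n + 1)) :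
    IsNCokernelSeq S ↔
      (∀ (a b : Fin (n + 2)) (_ : (a : ℕ) = n) (_ : (b : ℕ) = n + 1) (hab : a ≤ b) (Z : C)
        (h : S.obj b ⟶ Z), S.map (homOfLE hab) ≫ h = 0 → h = 0) ∧
      (∀ (a b c : Fin (n + 2)) (_ : (b : ℕ) = a + 1) (_ : (c : ℕ) = b + 1) (hab : a ≤ b)
        (hbc : b ≤ c) (Z : C) (h : S.obj b ⟶ Z),
        S.map (homOfLE hab) ≫ h = 0 ↔ ∃ k : S.obj c ⟶ Z, S.map (homOfLE hbc) ≫ k = h) := by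
  constructor
  · intro hS
    constructor
    · rintro ⟨a, ha⟩ ⟨b, hb⟩ h1 h2 hab Z h
      dsimp only at h1 h2
      subst h1 h2
      exact hS.injective Z h
    · rintro ⟨a, ha⟩ ⟨b, hb⟩ ⟨c, hc⟩ h1 h2 hab hbc Z h
      dsimp only at h1 h2
      subst h1 h2
      exact hS.exact a (by omega) Z h
  · rintro ⟨h1, h2⟩
    exact ⟨fun Z h => h1 _ _ rfl rfl _ Z h, fun i hi Z h => h2 _ _ _ rfl rfl _ _ Z h⟩

/-- The reversed sequence in the opposite category. -/
def opSeq {m : ℕ} (S : ComposableArrows C m) : ComposableArrows Cᵒᵖ m where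
  obj i := Opposite.op (S.obj i.rev)
  map f := (S.map (homOfLE (Fin.rev_le_rev.2 (leOfHom f)))).op
  map_id i := by
    rw [← op_id, ← S.map_id]; rfl
  map_comp f g := by
    rw [← op_comp, ← S.map_comp]; rfl

/-- The reversed sequence in the original category. -/
def unopSeq {m : ℕ} (S : ComposableArrows Cᵒᵖ m) : ComposableArrows C m where
  obj i := (S.obj i.rev).unop
  map f := (S.map (homOfLE (Fin.rev_le_rev.2 (leOfHom f)))).unop
  map_id i := by
    exact congrArg Quiver.Hom.unop (S.map_id i.rev)
  map_comp f g := by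
    rw [← unop_comp, ← S.map_comp]; rfl

lemma IsNKernelSeq.opSeq {n : ℕ} {S : ComposableArrows C (n + 1)} (h : IsNKernelSeq S) :
    IsNCokernelSeq (opSeq S) := by
  rw [isNKernelSeq_iff] at h
  rw [isNCokernelSeq_iff]
  refine ⟨fun a b ha hb hab Z f hf => ?_, fun a b c hb hc hab hbc Z f => ?_⟩
  · refine Quiver.Hom.unop_inj (h.1 b.rev a.rev ?_ ?_ (Fin.rev_le_rev.2 hab) Z.unop f.unop
      (Quiver.Hom.op_inj hf))
    all_goals simp [Fin.val_rev]; omega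
  · refine Iff.trans ?_ ((h.2 c.rev b.rev a.rev ?_ ?_ (Fin.rev_le_rev.2 hbc) (Fin.rev_le_rev.2 hab)
      Z.unop f.unop).trans ?_)
    · exact ⟨fun h => Quiver.Hom.op_inj h, fun h => Quiver.Hom.unop_inj h⟩
    · simp [Fin.val_rev]; omega
    · simp [Fin.val_rev]; omega
    · exact ⟨fun ⟨k, hk⟩ => ⟨k.op, Quiver.Hom.unop_inj hk⟩,
        fun ⟨k, hk⟩ => ⟨k.unop, Quiver.Hom.op_inj hk⟩⟩

lemma IsNCokernelSeq.unopSeq {n : ℕ} {S : ComposableArrows Cᵒᵖ (n + 1)} (h : IsNCokernelSeq S) :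
    IsNKernelSeq (unopSeq S) := by
  rw [isNCokernelSeq_iff] at h
  rw [isNKernelSeq_iff]
  refine ⟨fun a b ha hb hab Z f hf => ?_, fun a b c hb hc hab hbc Z f => ?_⟩
  · refine Quiver.Hom.op_inj (h.1 b.rev a.rev ?_ ?_ (Fin.rev_le_rev.2 hab) (Opposite.op Z) f.op
      (Quiver.Hom.unop_inj hf))
    all_goals simp [Fin.val_rev]; omega
  · refine Iff.trans ?_ ((h.2 c.rev b.rev a.rev ?_ ?_ (Fin.rev_le_rev.2 hbc) (Fin.rev_le_rev.2 hab)
      (Opposite.op Z) f.op).trans ?_)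
    · exact ⟨fun h => Quiver.Hom.unop_inj h, fun h => Quiver.Hom.op_inj h⟩
    · simp [Fin.val_rev]; omega
    · simp [Fin.val_rev]; omega
    · exact ⟨fun ⟨k, hk⟩ => ⟨k.unop, Quiver.Hom.op_inj hk⟩,
        fun ⟨k, hk⟩ => ⟨k.op, Quiver.Hom.unop_inj hk⟩⟩

end Sequences

/-! ### `n`-kernels and `n`-cokernels as iterated weak kernels and cokernels -/

section Iterated

variable {C : Type u} [Category.{v} C] [Preadditive C]

/-- `g` is a weak kernel of `f`. -/
def IsWeakKernel {X Y Z : C} (g : Z ⟶ X) (f : X ⟶ Y) : Prop :=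
  ∀ (W : C) (h : W ⟶ X), h ≫ f = 0 ↔ ∃ k : W ⟶ Z, k ≫ g = h

/-- `g` is a weak cokernel of `f`. -/
def IsWeakCokernel {X Y Z : C} (f : X ⟶ Y) (g : Y ⟶ Z) : Prop :=
  ∀ (W : C) (h : Y ⟶ W), f ≫ h = 0 ↔ ∃ k : Z ⟶ W, g ≫ k = h

/-- `f` admits `n` successive weak kernels, the last one being a monomorphism. -/
def HasIteratedKernel : ℕ → ∀ {X Y : C}, (X ⟶ Y) → Prop
  | 0, _, _, f => Mono f
  | n + 1, X, _, f => ∃ (Z : C) (g : Z ⟶ X), IsWeakKernel g f ∧ HasIteratedKernel n g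

/-- `f` admits `n` successive weak cokernels, the last one being an epimorphism. -/
def HasIteratedCokernel : ℕ → ∀ {X Y : C}, (X ⟶ Y) → Prop
  | 0, _, _, f => Epi f
  | n + 1, _, Y, f => ∃ (Z : C) (g : Y ⟶ Z), IsWeakCokernel f g ∧ HasIteratedCokernel n g

lemma hasIteratedKernel_op_iff (n : ℕ) {X Y : C} (f : X ⟶ Y) :
    HasIteratedKernel n f.op ↔ HasIteratedCokernel n f := by
  induction n generalizing X Y with
  | zero => exact op_mono_iff f
  | succ n ih =>
    constructor
    · rintro ⟨Z, g, h1, h2⟩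
      refine ⟨Z.unop, g.unop, fun W h => ?_, (ih _).1 h2⟩
      refine Iff.trans ?_ ((h1 (Opposite.op W) h.op).trans ?_)
      · exact ⟨fun h => Quiver.Hom.unop_inj h, fun h => Quiver.Hom.op_inj h⟩
      · exact ⟨fun ⟨k, hk⟩ => ⟨k.unop, Quiver.Hom.op_inj hk⟩,
          fun ⟨k, hk⟩ => ⟨k.op, Quiver.Hom.unop_inj hk⟩⟩
    · rintro ⟨Z, g, h1, h2⟩
      refine ⟨Opposite.op Z, g.op, fun W h => ?_, (ih _).2 h2⟩
      refine Iff.trans ?_ ((h1 W.unop h.unop).trans ?_)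
      · exact ⟨fun h => Quiver.Hom.op_inj h, fun h => Quiver.Hom.unop_inj h⟩
      · exact ⟨fun ⟨k, hk⟩ => ⟨k.op, Quiver.Hom.unop_inj hk⟩,
          fun ⟨k, hk⟩ => ⟨k.unop, Quiver.Hom.op_inj hk⟩⟩

lemma hasIteratedCokernel_op_iff (n : ℕ) {X Y : C} (f : X ⟶ Y) :
    HasIteratedCokernel n f.op ↔ HasIteratedKernel n f := by
  induction n generalizing X Y with
  | zero => exact op_epi_iff f
  | succ n ih =>
    constructor
    · rintro ⟨Z, g, h1, h2⟩
      refine ⟨Z.unop, g.unop, fun W h => ?_, (ih _).1 h2⟩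
      refine Iff.trans ?_ ((h1 (Opposite.op W) h.op).trans ?_)
      · exact ⟨fun h => Quiver.Hom.unop_inj h, fun h => Quiver.Hom.op_inj h⟩
      · exact ⟨fun ⟨k, hk⟩ => ⟨k.unop, Quiver.Hom.op_inj hk⟩,
          fun ⟨k, hk⟩ => ⟨k.op, Quiver.Hom.unop_inj hk⟩⟩
    · rintro ⟨Z, g, h1, h2⟩
      refine ⟨Opposite.op Z, g.op, fun W h => ?_, (ih _).2 h2⟩
      refine Iff.trans ?_ ((h1 W.unop h.unop).trans ?_)
      · exact ⟨fun h => Quiver.Hom.op_inj h, fun h => Quiver.Hom.unop_inj h⟩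
      · exact ⟨fun ⟨k, hk⟩ => ⟨k.op, Quiver.Hom.unop_inj hk⟩,
          fun ⟨k, hk⟩ => ⟨k.unop, Quiver.Hom.op_inj hk⟩⟩

lemma HasIteratedCokernel.iso_comp {n : ℕ} {X Y W : C} {f : X ⟶ Y} (e : W ≅ X)
    (h : HasIteratedCokernel n f) : HasIteratedCokernel n (e.hom ≫ f) := by
  cases n with
  | zero =>
    have : Epi f := h
    exact (inferInstance : Epi (e.hom ≫ f))
  | succ n =>
    obtain ⟨Z, g, h1, h2⟩ := h
    refine ⟨Z, g, fun V k => ?_, h2⟩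
    rw [← h1 V k, Category.assoc, Preadditive.IsIso.comp_left_eq_zero]

lemma HasIteratedCokernel.of_iso {n : ℕ} {X Y X' Y' : C} {f : X ⟶ Y} {f' : X' ⟶ Y'}
    (e : Arrow.mk f ≅ Arrow.mk f') (h : HasIteratedCokernel n f) : HasIteratedCokernel n f' := by
  obtain ⟨e₁, e₂, w⟩ := exists_iso_of_arrow_iso e
  have hf : f' = e₁.symm.hom ≫ f ≫ e₂.hom := by rw [← w]; simp
  rw [hf]
  refine HasIteratedCokernel.iso_comp _ ?_
  cases n with
  | zero =>
    have : Epi f := h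
    exact (inferInstance : Epi (f ≫ e₂.hom))
  | succ n =>
    obtain ⟨Z, g, h1, h2⟩ := h
    refine ⟨Z, e₂.symm.hom ≫ g, fun V k => ?_, h2.iso_comp e₂.symm⟩
    rw [Category.assoc, h1 V (e₂.hom ≫ k)]
    exact exists_congr fun l => by simp [Iso.inv_comp_eq]

lemma IsNCokernelSeq.hasIteratedCokernel {n : ℕ} {S : ComposableArrows C (n + 1)}
    (h : IsNCokernelSeq S) : HasIteratedCokernel n (S.map' 0 1) := by
  induction n with
  | zero => exact (Preadditive.epi_iff_cancel_zero _).2 h.injective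
  | succ n ih =>
    refine ⟨_, S.map' 1 2, h.exact 0 (by omega), ?_⟩
    -- Dropping the first object leaves a shorter cokernel sequence, starting with the weak
    -- cokernel.
    refine ih (S := S.δ₀) ⟨h.injective, fun i hi => ?_⟩
    exact h.exact (i + 1) (by omega)

lemma IsWeakCokernel.of_iso {X Y Z Y' Z' : C} {f : X ⟶ Y} {g : Y ⟶ Z} {s : Y' ⟶ Z'}
    {e₁ : Y' ≅ Y} {e₂ : Z' ≅ Z} (h : IsWeakCokernel f g) (w : e₁.hom ≫ g = s ≫ e₂.hom) :
    IsWeakCokernel (f ≫ e₁.inv) s := by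
  intro W k
  have w' : s = e₁.hom ≫ g ≫ e₂.inv := by rw [← Category.assoc, w]; simp
  rw [Category.assoc, h W, w']
  constructor
  · rintro ⟨l, hl⟩
    exact ⟨e₂.hom ≫ l, by simp [hl]⟩
  · rintro ⟨l, rfl⟩
    exact ⟨e₂.inv ≫ l, by simp⟩

lemma HasIteratedCokernel.hasNCokernel {n : ℕ} {X Y : C} {f : X ⟶ Y}
    (h : HasIteratedCokernel n f) : HasNCokernel n f := by
  induction n generalizing X Y with
  | zero =>
    have : Epi f := h
    refine ⟨ComposableArrows.mk₁ f, ⟨Iso.refl _⟩, fun Z k hk => ?_, fun i hi => by omega⟩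
    exact (Preadditive.epi_iff_cancel_zero f).1 this Z k hk
  | succ n ih =>
    obtain ⟨Z, g, h1, h2⟩ := h
    obtain ⟨S, ⟨e⟩, hS⟩ := ih h2
    obtain ⟨e₁, e₂, w⟩ := exists_iso_of_arrow_iso e
    -- The first arrow of `S` is only isomorphic to `g`, so `f` is corrected by `e₁.inv` before
    -- being prepended.
    refine ⟨S.precomp (f ≫ e₁.inv), ⟨Arrow.isoMk (Iso.refl _) e₁ ?_⟩, hS.injective, ?_⟩
    · change 𝟙 X ≫ f = (f ≫ e₁.inv) ≫ e₁.hom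
      exact (Category.id_comp f).trans ((Iso.comp_inv_eq e₁).1 rfl)
    · rintro (_ | i) hi W k
      · exact h1.of_iso w W k
      · exact hS.exact i (by omega) W k

lemma hasNCokernel_iff {n : ℕ} {X Y : C} (f : X ⟶ Y) :
    HasNCokernel n f ↔ HasIteratedCokernel n f :=
  ⟨fun ⟨_, ⟨e⟩, hS⟩ => hS.hasIteratedCokernel.of_iso e, fun h => h.hasNCokernel⟩

lemma hasNKernel_iff_op {n : ℕ} {X Y : C} (f : X ⟶ Y) :
    HasNKernel n f ↔ HasNCokernel n f.op := by
  constructor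
  · rintro ⟨S, ⟨e⟩, hS⟩
    refine ⟨opSeq S, ⟨?_⟩, hS.opSeq⟩
    exact arrowOpIso (eqToIso (arrow_eq_of_val_eq S (by simp [Fin.val_rev]) (by simp) _ _) ≪≫ e)
  · rintro ⟨S, ⟨e⟩, hS⟩
    refine ⟨unopSeq S, ⟨?_⟩, hS.unopSeq⟩
    exact arrowUnopIso
      (eqToIso (arrow_eq_of_val_eq S (by simp [Fin.val_rev]) (by simp [Fin.val_rev]) _ _) ≪≫ e)

lemma hasNKernel_iff {n : ℕ} {X Y : C} (f : X ⟶ Y) :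
    HasNKernel n f ↔ HasIteratedKernel n f := by
  rw [hasNKernel_iff_op, hasNCokernel_iff, hasIteratedCokernel_op_iff]

end Iterated

end NAb

/-! ### Halving the axioms: passage to the opposite category and to equivalent categories -/

namespace NAb

/-- The axioms (A1) and (A2). -/
structure HasNKernelAxioms (n : ℕ) (C : Type u) [Category.{v} C] [Preadditive C] : Prop where
  a1 : ∀ ⦃X Y : C⦄ (f : X ⟶ Y), HasNKernel n f
  a2 : ∀ S : ComposableArrows C (n + 1),
    Mono (S.map' 0 1) → IsNCokernelSeq S → IsNKernelSeq S

section Opposite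

variable {n : ℕ} {C : Type u} [Category.{v} C] [Preadditive C]

lemma IsNAbelian.hasNKernelAxioms (h : IsNAbelian n C) : HasNKernelAxioms n C :=
  ⟨h.a1, h.a2⟩

lemma mono_of_val_eq {C : Type u} [Category.{v} C] {m : ℕ} (S : ComposableArrows C m)
    {a b a' b' : Fin (m + 1)} (ha : (a : ℕ) = a') (hb : (b : ℕ) = b') (h : a ≤ b) (h' : a' ≤ b')
    (hm : Mono (S.map (homOfLE h))) : Mono (S.map (homOfLE h')) := by
  obtain rfl := Fin.ext ha
  obtain rfl := Fin.ext hb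
  exact hm

lemma epi_of_val_eq {C : Type u} [Category.{v} C] {m : ℕ} (S : ComposableArrows C m)
    {a b a' b' : Fin (m + 1)} (ha : (a : ℕ) = a') (hb : (b : ℕ) = b') (h : a ≤ b) (h' : a' ≤ b')
    (hm : Epi (S.map (homOfLE h))) : Epi (S.map (homOfLE h')) := by
  obtain rfl := Fin.ext ha
  obtain rfl := Fin.ext hb
  exact hm

lemma isNKernelSeq_of_unopSeq {S : ComposableArrows Cᵒᵖ (n + 1)}
    (h : IsNCokernelSeq (unopSeq S)) : IsNKernelSeq S := by
  rw [isNCokernelSeq_iff] at h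
  rw [isNKernelSeq_iff]
  refine ⟨fun a b ha hb hab Z f hf => ?_, fun a b c hb hc hab hbc Z f => ?_⟩
  -- Once the indices are written as reversals, the terms of `S` are definitionally those of
  -- `unopSeq S`.
  · obtain ⟨a, rfl⟩ := Fin.rev_surjective a
    obtain ⟨b, rfl⟩ := Fin.rev_surjective b
    simp only [Fin.val_rev] at ha hb
    exact Quiver.Hom.unop_inj (h.1 b a (by omega) (by omega) (Fin.rev_le_rev.1 hab) Z.unop f.unop
      (Quiver.Hom.op_inj hf))
  · obtain ⟨a, rfl⟩ := Fin.rev_surjective a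
    obtain ⟨b, rfl⟩ := Fin.rev_surjective b
    obtain ⟨c, rfl⟩ := Fin.rev_surjective c
    simp only [Fin.val_rev] at hb hc
    refine Iff.trans ?_ ((h.2 c b a (by omega) (by omega) (Fin.rev_le_rev.1 hbc)
      (Fin.rev_le_rev.1 hab) Z.unop f.unop).trans ?_)
    · exact ⟨fun h => Quiver.Hom.op_inj h, fun h => Quiver.Hom.unop_inj h⟩
    · exact ⟨fun ⟨k, hk⟩ => ⟨k.op, Quiver.Hom.unop_inj hk⟩,
        fun ⟨k, hk⟩ => ⟨k.unop, Quiver.Hom.op_inj hk⟩⟩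

lemma isNCokernelSeq_of_opSeq {S : ComposableArrows C (n + 1)}
    (h : IsNKernelSeq (opSeq S)) : IsNCokernelSeq S := by
  rw [isNKernelSeq_iff] at h
  rw [isNCokernelSeq_iff]
  refine ⟨fun a b ha hb hab Z f hf => ?_, fun a b c hb hc hab hbc Z f => ?_⟩
  · obtain ⟨a, rfl⟩ := Fin.rev_surjective a
    obtain ⟨b, rfl⟩ := Fin.rev_surjective b
    simp only [Fin.val_rev] at ha hb
    exact Quiver.Hom.op_inj (h.1 b a (by omega) (by omega) (Fin.rev_le_rev.1 hab) (Opposite.op Z)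
      f.op (Quiver.Hom.unop_inj hf))
  · obtain ⟨a, rfl⟩ := Fin.rev_surjective a
    obtain ⟨b, rfl⟩ := Fin.rev_surjective b
    obtain ⟨c, rfl⟩ := Fin.rev_surjective c
    simp only [Fin.val_rev] at hb hc
    refine Iff.trans ?_ ((h.2 c b a (by omega) (by omega) (Fin.rev_le_rev.1 hbc)
      (Fin.rev_le_rev.1 hab) (Opposite.op Z) f.op).trans ?_)
    · exact ⟨fun h => Quiver.Hom.unop_inj h, fun h => Quiver.Hom.op_inj h⟩
    · exact ⟨fun ⟨k, hk⟩ => ⟨k.unop, Quiver.Hom.op_inj hk⟩,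
        fun ⟨k, hk⟩ => ⟨k.op, Quiver.Hom.unop_inj hk⟩⟩

lemma IsNAbelian.hasNKernelAxioms_op (h : IsNAbelian n C) : HasNKernelAxioms n Cᵒᵖ := by
  constructor
  · intro X Y f
    rw [hasNKernel_iff]
    exact (hasIteratedKernel_op_iff n f.unop).2 ((hasNCokernel_iff _).1 (h.a1_op f.unop))
  · intro S hm hS
    refine isNKernelSeq_of_unopSeq (h.a2_op _ ?_ hS.unopSeq)
    have : Mono (S.map (homOfLE (Fin.rev_le_rev.2 (by simp [Fin.le_def] :
      (⟨n, (Nat.lt_succ_self n).trans (n + 1).lt_succ_self⟩ : Fin (n + 2)) ≤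
        ⟨n + 1, (n + 1).lt_succ_self⟩)))) :=
      mono_of_val_eq S (by simp [Fin.val_rev]) (by simp [Fin.val_rev]) _ _ hm
    exact @unop_epi_of_mono _ _ _ _ _ this

lemma IsNAbelian.of_hasNKernelAxioms [HasFiniteBiproducts C] [IsIdempotentComplete C]
    (h : HasNKernelAxioms n C) (h' : HasNKernelAxioms n Cᵒᵖ) : IsNAbelian n C where
  hasFiniteBiproducts := inferInstance
  isIdempotentComplete := inferInstance
  a1 := h.a1
  a1_op X Y f := by
    rw [hasNCokernel_iff, ← hasIteratedKernel_op_iff, ← hasNKernel_iff]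
    exact h'.a1 f.op
  a2 := h.a2
  a2_op S hm hS := by
    refine isNCokernelSeq_of_opSeq (h'.a2 _ ?_ hS.opSeq)
    have : Epi (S.map (homOfLE (Fin.rev_le_rev.2 (by simp :
      (0 : Fin (n + 2)) ≤ 1)))) :=
      epi_of_val_eq S (by simp [Fin.val_rev]) (by simp) _ _ hm
    exact @op_mono_of_epi _ _ _ _ _ this

end Opposite

section Transport

universe u₁ v₁ u₂ v₂

variable {C : Type u₁} [Category.{v₁} C] [Preadditive C] {D : Type u₂} [Category.{v₂} D]
  [Preadditive D] (F : C ⥤ D) [F.Additive]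

lemma IsWeakKernel.map [F.IsEquivalence] {X Y Z : C} {g : Z ⟶ X} {f : X ⟶ Y}
    (h : IsWeakKernel g f) : IsWeakKernel (F.map g) (F.map f) := by
  intro W k
  let e := F.objObjPreimageIso W
  obtain ⟨k', hk'⟩ := F.map_surjective (e.hom ≫ k)
  have h1 : k ≫ F.map f = 0 ↔ k' ≫ f = 0 := by
    rw [← Preadditive.IsIso.comp_left_eq_zero e.hom, ← Category.assoc, ← hk', ← F.map_comp,
      F.map_eq_zero_iff]
  rw [h1, h]
  constructor
  · rintro ⟨l, hl⟩
    refine ⟨e.inv ≫ F.map l, ?_⟩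
    rw [Category.assoc, ← F.map_comp, hl, hk']
    simp
  · rintro ⟨l, hl⟩
    obtain ⟨l', hl'⟩ := F.map_surjective (e.hom ≫ l)
    refine ⟨l', F.map_injective ?_⟩
    rw [F.map_comp, hl', Category.assoc, hl, hk']

lemma IsWeakKernel.of_map [F.Full] [F.Faithful] {X Y Z : C} {g : Z ⟶ X} {f : X ⟶ Y}
    (h : IsWeakKernel (F.map g) (F.map f)) : IsWeakKernel g f := by
  intro W k
  rw [← F.map_eq_zero_iff, F.map_comp, h]
  constructor
  · rintro ⟨l, hl⟩
    obtain ⟨l', rfl⟩ := F.map_surjective l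
    exact ⟨l', F.map_injective (by simpa using hl)⟩
  · rintro ⟨l, rfl⟩
    exact ⟨F.map l, by simp⟩

lemma IsWeakCokernel.map [F.IsEquivalence] {X Y Z : C} {f : X ⟶ Y} {g : Y ⟶ Z}
    (h : IsWeakCokernel f g) : IsWeakCokernel (F.map f) (F.map g) := by
  intro W k
  let e := F.objObjPreimageIso W
  obtain ⟨k', hk'⟩ := F.map_surjective (k ≫ e.inv)
  have h1 : F.map f ≫ k = 0 ↔ f ≫ k' = 0 := by
    rw [← Preadditive.IsIso.comp_right_eq_zero _ e.inv, Category.assoc, ← hk', ← F.map_comp,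
      F.map_eq_zero_iff]
  rw [h1, h]
  constructor
  · rintro ⟨l, hl⟩
    refine ⟨F.map l ≫ e.hom, ?_⟩
    rw [← Category.assoc, ← F.map_comp, hl, hk']
    simp
  · rintro ⟨l, hl⟩
    obtain ⟨l', hl'⟩ := F.map_surjective (l ≫ e.inv)
    refine ⟨l', F.map_injective ?_⟩
    rw [F.map_comp, hl', ← Category.assoc, hl, hk']

lemma IsNKernelSeq.map [F.IsEquivalence] {n : ℕ} {S : ComposableArrows C (n + 1)}
    (hS : IsNKernelSeq S) : IsNKernelSeq (S ⋙ F) := by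
  refine ⟨?_, fun i hi => IsWeakKernel.map F (hS.exact i hi)⟩
  have : Mono (S.map' 0 1) := Preadditive.mono_of_cancel_zero _ fun g => hS.injective _ g
  exact fun Z h hh => (Preadditive.mono_iff_cancel_zero (F.map (S.map' 0 1))).1 inferInstance _ h hh

lemma IsNKernelSeq.of_map [F.Full] [F.Faithful] {n : ℕ} {S : ComposableArrows C (n + 1)}
    (hS : IsNKernelSeq (S ⋙ F)) : IsNKernelSeq S := by
  refine ⟨fun Z h hh => ?_, fun i hi => IsWeakKernel.of_map F (hS.exact i hi)⟩
  refine (F.map_eq_zero_iff).1 (hS.injective _ (F.map h) ?_)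
  change F.map h ≫ F.map (S.map' 0 1) = 0
  rw [← F.map_comp, hh, F.map_zero]

lemma IsNCokernelSeq.map [F.IsEquivalence] {n : ℕ} {S : ComposableArrows C (n + 1)}
    (hS : IsNCokernelSeq S) : IsNCokernelSeq (S ⋙ F) := by
  refine ⟨?_, fun i hi => IsWeakCokernel.map F (hS.exact i hi)⟩
  have : Epi (S.map' n (n + 1)) := Preadditive.epi_of_cancel_zero _ fun g => hS.injective _ g
  exact fun Z h hh =>
    (Preadditive.epi_iff_cancel_zero (F.map (S.map' n (n + 1)))).1 inferInstance _ h hh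

variable {F}

lemma HasNKernelAxioms.of_equivalence {n : ℕ} (e : C ≌ D) [e.functor.Additive]
    (h : HasNKernelAxioms n C) : HasNKernelAxioms n D := by
  have : e.inverse.Additive := e.inverse_additive
  constructor
  · intro X Y f
    obtain ⟨S, ⟨i⟩, hS⟩ := h.a1 (e.inverse.map f)
    refine ⟨S ⋙ e.functor, ⟨?_⟩, hS.map e.functor⟩
    refine e.functor.mapArrow.mapIso i ≪≫ Arrow.isoMk (e.counitIso.app X) (e.counitIso.app Y) ?_
    exact (e.counitIso.hom.naturality f).symm
  · intro S hm hS
    refine IsNKernelSeq.of_map e.inverse (h.a2 _ ?_ (hS.map e.inverse))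
    exact (inferInstance : Mono (e.inverse.map (S.map' 0 1)))

end Transport

end NAb

/-! ### Weak kernels of projectives and coherence -/

namespace NAb

variable {R : Type v} [Ring R]

instance (P : FGProj R) : Module.Finite R P.obj := P.property.1
instance (P : FGProj R) : Module.Projective R P.obj := P.property.2
instance (P : FGProj R) : Module.FinitePresentation R P.obj :=
  Module.finitePresentation_of_projective R P.obj

/-- The object of `FGProj R` given by a finitely generated projective module. -/
abbrev fgp (P : Type v) [AddCommGroup P] [Module R P] [h : Module.Finite R P]
    [h' : Module.Projective R P] : FGProj R := ⟨ModuleCat.of R P, h, h'⟩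

/-- The morphism of `FGProj R` given by a linear map. -/
abbrev fgpHom {M N : FGProj R} (f : M.obj →ₗ[R] N.obj) : M ⟶ N :=
  ObjectProperty.homMk (ModuleCat.ofHom f)

lemma FGProj.comp_eq_zero_iff {M N K : FGProj R} (f : M ⟶ N) (g : N ⟶ K) :
    f ≫ g = 0 ↔ g.hom.hom ∘ₗ f.hom.hom = 0 := by
  constructor
  · intro h
    exact congrArg (fun k => k.hom.hom) h
  · intro h
    ext x
    exact congrArg (fun k => k x) h

/-- Testing on `R` detects elements; conversely, a map from a projective into the range of `f` lifts
through `f`. -/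
lemma FGProj.isWeakKernel_iff {M N K : FGProj R} (f : M ⟶ N) (g : N ⟶ K) :
    IsWeakKernel f g ↔ Function.Exact f.hom.hom g.hom.hom := by
  constructor
  · intro h x
    constructor
    · intro hx
      obtain ⟨k, hk⟩ := (h (fgp R) (fgpHom (LinearMap.toSpanSingleton R N.obj x))).1 (by
        rw [FGProj.comp_eq_zero_iff]
        ext
        simpa using hx)
      refine ⟨k.hom.hom (1 : R), (congrArg (fun q => q.hom.hom (1 : R)) hk).trans ?_⟩
      simp
    · rintro ⟨y, rfl⟩
      exact LinearMap.congr_fun ((FGProj.comp_eq_zero_iff f g).1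
        ((h M f).2 ⟨𝟙 M, Category.id_comp f⟩)) y
  · intro h W k
    rw [FGProj.comp_eq_zero_iff]
    constructor
    · intro hk
      obtain ⟨l, hl⟩ := Module.projective_lifting_property f.hom.hom.rangeRestrict
        (k.hom.hom.codRestrict (LinearMap.range f.hom.hom)
          (fun w => (h _).1 (LinearMap.congr_fun hk w))) f.hom.hom.surjective_rangeRestrict
      refine ⟨fgpHom l, ?_⟩
      ext w
      exact congrArg Subtype.val (LinearMap.congr_fun hl w)
    · rintro ⟨l, rfl⟩
      ext w
      exact (h _).2 ⟨l.hom.hom w, rfl⟩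

lemma FGProj.mono_iff {M N : FGProj R} (f : M ⟶ N) :
    Mono f ↔ Function.Injective f.hom.hom := by
  constructor
  · intro h
    rw [← LinearMap.ker_eq_bot, LinearMap.ker_eq_bot']
    intro x hx
    have : fgpHom (M := fgp R) (N := M) (LinearMap.toSpanSingleton R M.obj x) = fgpHom 0 := by
      rw [← cancel_mono f]
      ext
      simp [hx]
    have h2 := congrArg (fun g => g.hom.hom (1 : R)) this
    simpa using h2
  · intro h
    have : Mono f.hom := (ModuleCat.mono_iff_injective _).2 h
    exact (ObjectProperty.ι _).mono_of_mono_map this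

/-- If kernels of maps between finitely generated projective modules are finitely generated, so are
kernels of maps from finitely generated projective modules to finitely presented modules. -/
lemma fg_ker_of_projective
    (h : ∀ (P Q : FGProj R) (f : P.obj →ₗ[R] Q.obj), (LinearMap.ker f).FG)
    {P N : Type v} [AddCommGroup P] [Module R P] [AddCommGroup N] [Module R N]
    [Module.Finite R P] [Module.Projective R P] [Module.FinitePresentation R N]
    (f : P →ₗ[R] N) : (LinearMap.ker f).FG := by
  obtain ⟨n, π, hπ⟩ := Module.Finite.exists_fin' R N
  have hk : (LinearMap.ker π).FG := Module.FinitePresentation.fg_ker π hπ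
  have : Module.Finite R (LinearMap.ker π) := Module.Finite.iff_fg.2 hk
  obtain ⟨m, j, hj⟩ := Module.Finite.exists_fin' R (LinearMap.ker π)
  obtain ⟨l, hl⟩ := Module.projective_lifting_property π f hπ
  -- An element `p` lies in `ker f` exactly when its lift `l p` lies in `ker π`, that is, equals `j
  -- q` for some `q`. So `ker f` is the projection to `P` of the kernel of `(p, q) ↦ l p - j q`, a
  -- map between projectives.
  let Φ : (P × (Fin m → R)) →ₗ[R] (Fin n → R) :=
    l.coprod (-((LinearMap.ker π).subtype ∘ₗ j))
  have hΦ := h (fgp (P × (Fin m → R))) (fgp (Fin n → R)) Φ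
  convert hΦ.map (LinearMap.fst R P (Fin m → R))
  ext p
  simp only [LinearMap.mem_ker, Submodule.mem_map]
  constructor
  · intro hp
    have hp' : l p ∈ LinearMap.ker π := by
      rw [LinearMap.mem_ker, ← hp, ← hl]; rfl
    obtain ⟨q, hq⟩ := hj ⟨l p, hp'⟩
    refine ⟨(p, q), ?_, rfl⟩
    simp [Φ, hq]
  · rintro ⟨⟨p', q⟩, h1, rfl⟩
    have h2 : l p' = (j q : Fin n → R) := by
      simpa [Φ, add_neg_eq_zero] using h1
    have h3 : f p' = π (l p') := by rw [← hl]; rfl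
    change f p' = 0
    rw [h3, h2]
    exact (j q).2

lemma hasFPKernels_of_fg_ker
    (h : ∀ (P Q : FGProj R) (f : P.obj →ₗ[R] Q.obj), (LinearMap.ker f).FG) :
    HasFPKernels R := by
  intro M N _ _ _ _ g _ _
  obtain ⟨n, p, hp⟩ := Module.Finite.exists_fin' R M
  have h1 : (LinearMap.ker g).FG := by
    have := (fg_ker_of_projective h (g ∘ₗ p)).map p
    convert this
    rw [LinearMap.ker_comp, Submodule.map_comap_eq_of_surjective hp]
  have : Module.Finite R (LinearMap.ker g) := Module.Finite.iff_fg.2 h1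
  obtain ⟨m, q, hq⟩ := Module.Finite.exists_fin' R (LinearMap.ker g)
  -- The kernel of `q` is also the kernel of the composite into the finitely presented module `M`,
  -- so the previous lemma applies a second time.
  refine Module.finitePresentation_of_surjective q hq ?_
  have h2 := fg_ker_of_projective h ((LinearMap.ker g).subtype ∘ₗ q)
  rwa [LinearMap.ker_comp_of_ker_eq_bot _ (Submodule.ker_subtype _)] at h2

lemma hasFPKernels_of_hasNKernel {n : ℕ} (hn : 1 ≤ n)
    (h : ∀ ⦃X Y : FGProj R⦄ (f : X ⟶ Y), HasNKernel n f) : HasFPKernels R := by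
  refine hasFPKernels_of_fg_ker fun P Q f => ?_
  obtain ⟨n, rfl⟩ := Nat.exists_eq_succ_of_ne_zero (by omega : n ≠ 0)
  obtain ⟨Z, g, hg, -⟩ := (hasNKernel_iff _).1 (h (fgpHom f))
  rw [FGProj.isWeakKernel_iff] at hg
  have : LinearMap.ker f = LinearMap.range g.hom.hom := hg.linearMap_ker_eq
  rw [this, LinearMap.range_eq_map]
  exact Module.Finite.fg_top.map _

lemma FPMod.projective_of_module_projective (M : FPMod R) [Module.Projective R M.obj] :
    Projective M where
  factors {E X} f e _ := by
    obtain ⟨l, hl⟩ := Module.projective_lifting_property e.hom.hom f.hom.hom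
      (FPMod.surjective_of_epi e)
    exact ⟨fpHom l, by ext x; exact LinearMap.congr_fun hl x⟩

lemma FPMod.module_projective (M : FPMod R) [Projective M] : Module.Projective R M.obj := by
  obtain ⟨n, p, hp⟩ := Module.Finite.exists_fin' R M.obj
  have := FPMod.epi_of_surjective (fpHom p : fp (Fin n → R) ⟶ M) hp
  let s := Projective.factorThru (𝟙 M) (fpHom p : fp (Fin n → R) ⟶ M)
  have hs : s ≫ fpHom p = 𝟙 M := Projective.factorThru_comp _ _
  exact Module.Projective.of_split s.hom.hom p (congrArg (fun k => k.hom.hom) hs)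

lemma FPMod.isZero_iff (M : FPMod R) : IsZero M ↔ Subsingleton M.obj := by
  constructor
  · intro h
    have : 𝟙 M = fpHom 0 := h.eq_of_src _ _
    have h2 : ∀ x : M.obj, x = 0 := fun x => congrArg (fun k => k.hom.hom x) this
    exact ⟨fun a b => by rw [h2 a, h2 b]⟩
  · intro h
    have : IsZero M.obj := ModuleCat.isZero_of_subsingleton _
    exact ⟨fun X => ⟨⟨⟨fpHom 0⟩, fun _ => ObjectProperty.hom_ext _ (this.eq_of_src _ _)⟩⟩,
        fun X => ⟨⟨⟨fpHom 0⟩, fun _ => ObjectProperty.hom_ext _ (this.eq_of_tgt _ _)⟩⟩⟩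

end NAb

/-! ### `n`-kernels and global dimension -/

namespace NAb

variable {R : Type v} [Ring R]

lemma FPMod.isShortExact_ker {M N : Type v} [AddCommGroup M] [Module R M] [AddCommGroup N]
    [Module R N] [Module.FinitePresentation R M] [Module.FinitePresentation R N]
    (p : M →ₗ[R] N) (hp : Function.Surjective p) [Module.FinitePresentation R (LinearMap.ker p)] :
    IsShortExact (fpHom (LinearMap.ker p).subtype : fp (R := R) (LinearMap.ker p) ⟶ fp M)
      (fpHom p : fp M ⟶ fp N) :=
  FPMod.isShortExact _ _ Subtype.val_injective (LinearMap.exact_subtype_ker_map p) hp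

lemma FPMod.isShortExact_of_exact {M N K : Type v} [AddCommGroup M] [Module R M] [AddCommGroup N]
    [Module R N] [AddCommGroup K] [Module R K]
    [Module.FinitePresentation R M] [Module.FinitePresentation R N]
    [Module.FinitePresentation R K] (f : M →ₗ[R] N) (g : N →ₗ[R] K)
    (hf : Function.Injective f) (hfg : Function.Exact f g) (hg : Function.Surjective g) :
    IsShortExact (fpHom f : fp (R := R) M ⟶ fp N) (fpHom g : fp N ⟶ fp K) :=
  FPMod.isShortExact _ _ hf hfg hg

lemma HasFPKernels.range (h : HasFPKernels R) {M N : Type v} [AddCommGroup M] [Module R M]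
    [AddCommGroup N] [Module R N] [Module.FinitePresentation R M] [Module.FinitePresentation R N]
    (f : M →ₗ[R] N) : Module.FinitePresentation R (LinearMap.range f) := by
  have := finitePresentation_quotient_range f
  have h2 := h (LinearMap.range f).mkQ inferInstance inferInstance
  rwa [Submodule.ker_mkQ] at h2

variable [Abelian (FPMod R)]

lemma FPMod.hasProjectiveDimensionLT_of_projective (M : Type v) [AddCommGroup M] [Module R M]
    [Module.FinitePresentation R M] [Module.Projective R M] (n : ℕ) :
    HasProjectiveDimensionLT (fp (R := R) M) (n + 1) := by
  have : Projective (fp (R := R) M) := FPMod.projective_of_module_projective _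
  exact hasProjectiveDimensionLT_of_ge _ 1 (n + 1) (by omega)

lemma FPMod.hasProjectiveDimensionLT_of_equiv {M N : Type v} [AddCommGroup M] [Module R M]
    [AddCommGroup N] [Module R N] [Module.FinitePresentation R M] [Module.FinitePresentation R N]
    (e : M ≃ₗ[R] N) (n : ℕ) [HasProjectiveDimensionLT (fp (R := R) M) n] :
    HasProjectiveDimensionLT (fp (R := R) N) n :=
  hasProjectiveDimensionLT_of_iso
    (ObjectProperty.isoMk _ e.toModuleIso : fp (R := R) M ≅ fp N) n

/-- The iterated weak kernels form a finite projective resolution of `ker f`. Each step is the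
sequence `0 → ker g → Z → ker f → 0`, and the final monomorphism has zero kernel. -/
lemma HasIteratedKernel.hasProjectiveDimensionLT {n : ℕ} {X Y : FGProj R} {f : X ⟶ Y}
    (h : HasIteratedKernel n f) [Module.FinitePresentation R (LinearMap.ker f.hom.hom)] :
    HasProjectiveDimensionLT (fp (R := R) (LinearMap.ker f.hom.hom)) n := by
  induction n generalizing X Y with
  | zero =>
    rw [hasProjectiveDimensionLT_zero_iff_isZero, FPMod.isZero_iff]
    have : Mono f := h
    rw [FGProj.mono_iff, ← LinearMap.ker_eq_bot] at this
    exact Submodule.subsingleton_iff_eq_bot.2 this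
  | succ n ih =>
    obtain ⟨Z, g, h1, h2⟩ := h
    rw [FGProj.isWeakKernel_iff] at h1
    have : Module.FinitePresentation R (LinearMap.ker g.hom.hom) :=
      hasFPKernels_of_abelian _ inferInstance inferInstance
    let g' : Z.obj →ₗ[R] LinearMap.ker f.hom.hom :=
      g.hom.hom.codRestrict _ (fun z => (h1 _).2 ⟨z, rfl⟩)
    have hs := FPMod.isShortExact_of_exact (LinearMap.ker g.hom.hom).subtype g'
      Subtype.val_injective
      (fun z => by
        have : g' z = 0 ↔ z ∈ LinearMap.ker g.hom.hom := by
          rw [← Subtype.coe_inj]; rfl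
        simp [this])
      (fun ⟨x, hx⟩ => by
        obtain ⟨z, hz⟩ := (h1 x).1 hx
        exact ⟨z, Subtype.ext hz⟩)
    exact hs.hasProjectiveDimensionLT_right n (ih h2)
      (FPMod.hasProjectiveDimensionLT_of_projective _ n)

lemma hasIteratedKernel_of_hasProjectiveDimensionLT {n : ℕ} {X Y : FGProj R} (f : X ⟶ Y)
    [Module.FinitePresentation R (LinearMap.ker f.hom.hom)]
    (h : HasProjectiveDimensionLT (fp (R := R) (LinearMap.ker f.hom.hom)) n) :
    HasIteratedKernel n f := by
  induction n generalizing X Y with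
  | zero =>
    rw [hasProjectiveDimensionLT_zero_iff_isZero, FPMod.isZero_iff] at h
    refine (FGProj.mono_iff f).2 ?_
    rw [← LinearMap.ker_eq_bot]
    exact Submodule.subsingleton_iff_eq_bot.1 h
  | succ n ih =>
    cases n with
    -- A projective kernel is taken itself as the next term; a free cover of it could have a nonzero
    -- kernel, with no step left to resolve it.
    | zero =>
      have : Module.Projective R (LinearMap.ker f.hom.hom) :=
        FPMod.module_projective (fp (LinearMap.ker f.hom.hom))
      refine ⟨fgp (LinearMap.ker f.hom.hom), fgpHom (LinearMap.ker f.hom.hom).subtype, ?_, ?_⟩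
      · rw [FGProj.isWeakKernel_iff]
        exact LinearMap.exact_subtype_ker_map _
      · exact (FGProj.mono_iff _).2 Subtype.val_injective
    | succ n =>
      obtain ⟨m, p, hp⟩ := Module.Finite.exists_fin' R (LinearMap.ker f.hom.hom)
      let g : fgp (Fin m → R) ⟶ X := fgpHom ((LinearMap.ker f.hom.hom).subtype ∘ₗ p)
      refine ⟨fgp (Fin m → R), g, ?_, ?_⟩
      · rw [FGProj.isWeakKernel_iff]
        intro x
        constructor
        · intro hx
          obtain ⟨y, hy⟩ := hp ⟨x, hx⟩
          exact ⟨y, congrArg Subtype.val hy⟩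
        · rintro ⟨y, rfl⟩
          exact (p y).2
      · have hk : LinearMap.ker g.hom.hom = LinearMap.ker p :=
          LinearMap.ker_comp_of_ker_eq_bot _ (Submodule.ker_subtype _)
        have : Module.FinitePresentation R (LinearMap.ker g.hom.hom) :=
          hasFPKernels_of_abelian _ inferInstance inferInstance
        have : Module.FinitePresentation R (LinearMap.ker p) :=
          hasFPKernels_of_abelian _ inferInstance inferInstance
        have hs := FPMod.isShortExact_ker p hp
        have := hs.hasProjectiveDimensionLT_left (n + 1)
          (FPMod.hasProjectiveDimensionLT_of_projective _ n) h
        exact ih _ (FPMod.hasProjectiveDimensionLT_of_equiv (LinearEquiv.ofEq _ _ hk.symm) _)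

/-- Every `M` is the cokernel of a map of free modules whose kernel is a second syzygy of `M`. That
kernel has dimension `< n`, and the two short exact sequences raise the bound to `< n + 2`. -/
lemma globalDimensionLE_of_hasNKernel {n : ℕ}
    (h : ∀ ⦃X Y : FGProj R⦄ (f : X ⟶ Y), HasNKernel n f) :
    GlobalDimensionLE (FPMod R) (n + 1) := by
  intro M
  have hcoh : HasFPKernels R := hasFPKernels_of_abelian
  obtain ⟨m, p, hp⟩ := Module.Finite.exists_fin' R M.obj
  have := hcoh p inferInstance inferInstance
  obtain ⟨l, q, hq⟩ := Module.Finite.exists_fin' R (LinearMap.ker p)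
  let f : fgp (Fin l → R) ⟶ fgp (Fin m → R) := fgpHom ((LinearMap.ker p).subtype ∘ₗ q)
  have hk : LinearMap.ker f.hom.hom = LinearMap.ker q :=
    LinearMap.ker_comp_of_ker_eq_bot _ (Submodule.ker_subtype _)
  have := hcoh q inferInstance inferInstance
  have : Module.FinitePresentation R (LinearMap.ker f.hom.hom) :=
    hcoh _ inferInstance inferInstance
  have h1 := ((hasNKernel_iff _).1 (h f)).hasProjectiveDimensionLT
  have h2 := FPMod.hasProjectiveDimensionLT_of_equiv (LinearEquiv.ofEq _ _ hk) n
  have h3 := (FPMod.isShortExact_ker q hq).hasProjectiveDimensionLT_right n h2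
    (FPMod.hasProjectiveDimensionLT_of_projective _ n)
  exact (FPMod.isShortExact_ker p hp).hasProjectiveDimensionLT_right (n + 1) h3
    (FPMod.hasProjectiveDimensionLT_of_projective _ (n + 1))

lemma FPMod.hasProjectiveDimensionLT_range {n : ℕ} {X Y : FGProj R} (f : X.obj →ₗ[R] Y.obj)
    [Module.FinitePresentation R (Y.obj ⧸ LinearMap.range f)]
    [Module.FinitePresentation R (LinearMap.range f)]
    (h : HasProjectiveDimensionLT (fp (R := R) (Y.obj ⧸ LinearMap.range f)) (n + 2)) :
    HasProjectiveDimensionLT (fp (R := R) (LinearMap.range f)) (n + 1) :=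
  (FPMod.isShortExact_of_exact (LinearMap.range f).subtype (LinearMap.range f).mkQ
    Subtype.val_injective (LinearMap.exact_subtype_mkQ _)
    (Submodule.mkQ_surjective _)).hasProjectiveDimensionLT_left (n + 1)
    (FPMod.hasProjectiveDimensionLT_of_projective _ n) h

lemma hasNKernel_of_globalDimensionLE {n : ℕ} (hn : 1 ≤ n)
    (h : GlobalDimensionLE (FPMod R) (n + 1)) ⦃X Y : FGProj R⦄ (f : X ⟶ Y) : HasNKernel n f := by
  rw [hasNKernel_iff]
  have hcoh : HasFPKernels R := hasFPKernels_of_abelian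
  have := hcoh f.hom.hom inferInstance inferInstance
  have := hcoh.range f.hom.hom
  have := finitePresentation_quotient_range f.hom.hom
  have h1 := FPMod.hasProjectiveDimensionLT_range f.hom.hom (h (fp _))
  refine hasIteratedKernel_of_hasProjectiveDimensionLT f ?_
  -- Bounding the dimension of `ker f` by `< n` requires the same bound for the projective domain,
  -- hence `n ≥ 1`.
  obtain ⟨n, rfl⟩ := Nat.exists_eq_succ_of_ne_zero (by omega : n ≠ 0)
  exact (FPMod.isShortExact_of_exact (LinearMap.ker f.hom.hom).subtype f.hom.hom.rangeRestrict
    Subtype.val_injective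
    (fun x => by
      have : f.hom.hom.rangeRestrict x = 0 ↔ x ∈ LinearMap.ker f.hom.hom := by
        rw [← Subtype.coe_inj]; rfl
      simp [this])
    f.hom.hom.surjective_rangeRestrict).hasProjectiveDimensionLT_left (n + 1)
    (FPMod.hasProjectiveDimensionLT_of_projective _ n) h1

end NAb

/-! ### Duality of projective modules, and Ext of transposes -/

namespace NAb

/-- A bimodule which is free of rank one on a common generator on both sides. -/
def IsBiregular (R S B : Type v) [Ring R] [Ring S] [AddCommGroup B] [Module R B] [Module S B] :
    Prop :=
  ∃ b : B, Function.Bijective (fun r : R => r • b) ∧ Function.Bijective (fun s : S => s • b)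

lemma IsBiregular.symm {R S B : Type v} [Ring R] [Ring S] [AddCommGroup B] [Module R B]
    [Module S B] (h : IsBiregular R S B) : IsBiregular S R B :=
  let ⟨b, h₁, h₂⟩ := h
  ⟨b, h₂, h₁⟩

lemma IsBiregular.exists_equiv {R S B : Type v} [Ring R] [Ring S] [AddCommGroup B] [Module R B]
    [Module S B] (h : IsBiregular R S B) : Nonempty (R ≃ₗ[R] B) :=
  let ⟨b, h₁, _⟩ := h
  ⟨LinearEquiv.ofBijective (LinearMap.toSpanSingleton R B b) h₁⟩

lemma exists_lift_of_surjective {R M N P : Type*} [Ring R] [AddCommGroup M] [Module R M]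
    [AddCommGroup N] [Module R N] [AddCommGroup P] [Module R P] {q : M →ₗ[R] N}
    (hq : Function.Surjective q) (f : M →ₗ[R] P) (h : ∀ x, q x = 0 → f x = 0) :
    ∃ θ : N →ₗ[R] P, ∀ x, θ (q x) = f x := by
  refine ⟨(LinearMap.ker q).liftQ f h ∘ₗ (q.quotKerEquivOfSurjective hq).symm.toLinearMap,
    fun x => ?_⟩
  have : (q.quotKerEquivOfSurjective hq).symm (q x) = Submodule.Quotient.mk x := by
    rw [LinearEquiv.symm_apply_eq]; rfl
  simp only [LinearMap.comp_apply, LinearEquiv.coe_coe, this]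
  exact Submodule.liftQ_apply _ _ _

lemma exists_dual_basis {R P : Type*} [Ring R] [AddCommGroup P] [Module R P] [Module.Finite R P]
    [Module.Projective R P] :
    ∃ (k : ℕ) (x : Fin k → P) (f : Fin k → (P →ₗ[R] R)), ∀ p, p = ∑ i, f i p • x i := by
  obtain ⟨k, π, hπ⟩ := Module.Finite.exists_fin' R P
  obtain ⟨s, hs⟩ := Module.projective_lifting_property π LinearMap.id hπ
  refine ⟨k, fun i => π (Pi.single i 1), fun i => LinearMap.proj i ∘ₗ s, fun p => ?_⟩
  conv_lhs => rw [show p = π (s p) from (LinearMap.congr_fun hs p).symm]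
  rw [LinearMap.pi_apply_eq_sum_univ π (s p)]
  refine Finset.sum_congr rfl fun i _ => ?_
  congr 2
  ext j
  simp [Pi.single_apply, eq_comm]

lemma IsBiregular.dual_separates {R S B : Type v} [Ring R] [Ring S]
    [AddCommGroup B] [Module R B] [Module S B] (hB : IsBiregular R S B) {P : Type v} [AddCommGroup P]
    [Module R P] [Module.Finite R P] [Module.Projective R P] (p : P)
    (h : ∀ φ : P →ₗ[R] B, φ p = 0) : p = 0 := by
  obtain ⟨k, x, f, hf⟩ := exists_dual_basis (R := R) (P := P)
  obtain ⟨b, h₁, h₂⟩ := hB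
  have hz : ∀ i, f i p = 0 := fun i => h₁.1 (by
    simpa using h (LinearMap.toSpanSingleton R B b ∘ₗ f i))
  rw [hf p]
  exact Finset.sum_eq_zero fun i _ => by rw [hz i, zero_smul]

variable {R S : Type v} [Ring R] [Ring S] {B : Type v} [AddCommGroup B] [Module R B] [Module S B]
  [SMulCommClass R S B]

/-- A retraction of `R^k` onto `P` dualizes to a retraction of `Hom(R^k, B) ≅ S^k` onto `Hom(P, B)`.
-/
lemma IsBiregular.finite_projective_dual (hB : IsBiregular R S B) (P : Type v) [AddCommGroup P]
    [Module R P] [Module.Finite R P] [Module.Projective R P] :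
    Module.Finite S (P →ₗ[R] B) ∧ Module.Projective S (P →ₗ[R] B) := by
  obtain ⟨k, π, hπ⟩ := Module.Finite.exists_fin' R P
  obtain ⟨s, hs⟩ := Module.projective_lifting_property π LinearMap.id hπ
  obtain ⟨e⟩ := hB.symm.exists_equiv
  let e' : (Fin k → S) ≃ₗ[S] ((Fin k → R) →ₗ[R] B) :=
    (LinearEquiv.piCongrRight fun _ => e ≪≫ₗ (LinearMap.ringLmapEquivSelf R S B).symm) ≪≫ₗ
      LinearMap.lsum R (fun _ : Fin k => R) S
  have : Module.Finite S ((Fin k → R) →ₗ[R] B) := Module.Finite.equiv e'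
  have : Module.Projective S ((Fin k → R) →ₗ[R] B) := Module.Projective.of_equiv e'
  have h : LinearMap.lcomp S B s ∘ₗ LinearMap.lcomp S B π = LinearMap.id := by
    ext φ p
    exact congrArg φ (LinearMap.congr_fun hs p)
  refine ⟨Module.Finite.of_surjective (LinearMap.lcomp S B s) fun φ => ⟨_, LinearMap.congr_fun h φ⟩,
    Module.Projective.of_split _ _ h⟩

/-- Together with `IsBiregular.dual_separates` this is the reflexivity of finitely generated
projectives. -/
lemma IsBiregular.exists_eval (hB : IsBiregular R S B) {P : Type v} [AddCommGroup P]
    [Module R P] [Module.Finite R P] [Module.Projective R P] (Ψ : (P →ₗ[R] B) →ₗ[S] B) :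
    ∃ p : P, ∀ φ, Ψ φ = φ p := by
  obtain ⟨k, x, f, hf⟩ := exists_dual_basis (R := R) (P := P)
  obtain ⟨b, h₁, h₂⟩ := hB
  -- The dual basis transported to `B`. A functional on the dual is determined by its values on the
  -- `F i`; writing these as `r i • b` gives the coefficients of the required element. The two
  -- actions on `b` commute, which is what makes the formula work.
  let F : Fin k → (P →ₗ[R] B) := fun i => LinearMap.toSpanSingleton R B b ∘ₗ f i
  choose r hr using fun i => h₁.2 (Ψ (F i))
  refine ⟨∑ i, r i • x i, fun φ => ?_⟩
  choose s hs using fun i => h₂.2 (φ (x i))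
  have hφ : φ = ∑ i, s i • F i := by
    ext p
    conv_lhs => rw [hf p]
    simp only [map_sum, map_smul, LinearMap.sum_apply, LinearMap.smul_apply]
    refine Finset.sum_congr rfl fun i _ => ?_
    rw [← hs i]
    exact smul_comm _ _ _
  have h3 : ∀ i, r i • φ (x i) = s i • Ψ (F i) := fun i => by
    rw [← hs i, ← hr i]
    exact smul_comm _ _ _
  rw [map_sum]
  simp only [map_smul, h3]
  conv_lhs => rw [hφ]
  simp

/-- `B` is itself a finitely generated projective `R`-module, so it can serve as a test object for
the weak cokernel. -/
lemma IsWeakCokernel.dual_exact (hB : IsBiregular R S B) {X Y Z : FGProj R} {f : X ⟶ Y}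
    {g : Y ⟶ Z} (h : IsWeakCokernel f g) :
    Function.Exact (LinearMap.lcomp S B g.hom.hom) (LinearMap.lcomp S B f.hom.hom) := by
  obtain ⟨e⟩ := hB.exists_equiv
  have : Module.Finite R B := Module.Finite.equiv e
  have : Module.Projective R B := Module.Projective.of_equiv e
  intro φ
  have h1 := h (fgp B) (fgpHom φ)
  rw [FGProj.comp_eq_zero_iff] at h1
  refine h1.trans ⟨fun ⟨k, hk⟩ => ⟨k.hom.hom, congrArg (fun l => l.hom.hom) hk⟩,
    fun ⟨k, hk⟩ => ⟨fgpHom k, ?_⟩⟩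
  ext y
  exact LinearMap.congr_fun hk y

/-- `N` is the cokernel of the dual of `f`. -/
def IsDualCokernel (B : Type v) [AddCommGroup B] [Module R B] [Module S B]
    [SMulCommClass R S B] {X Y : FGProj R} (f : X ⟶ Y) (N : FPMod S) : Prop :=
  ∃ q : (X.obj →ₗ[R] B) →ₗ[S] N.obj,
    Function.Surjective q ∧ Function.Exact (LinearMap.lcomp S B f.hom.hom) q

lemma IsDualCokernel.of_iso {X Y X' Y' : FGProj R} {f : X ⟶ Y} {f' : X' ⟶ Y'} {N : FPMod S}
    (h : IsDualCokernel B f' N) (e : Arrow.mk f ≅ Arrow.mk f') : IsDualCokernel B f N := by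
  obtain ⟨e₁, e₂, w⟩ := exists_iso_of_arrow_iso e
  obtain ⟨q, hq, hqf⟩ := h
  have w' : ∀ x, f'.hom.hom (e₁.hom.hom.hom x) = e₂.hom.hom.hom (f.hom.hom x) := fun x =>
    congrArg (fun k => k.hom.hom x) w
  have i₁ : ∀ x, e₁.hom.hom.hom (e₁.inv.hom.hom x) = x := fun x =>
    congrArg (fun k => k.hom.hom x) e₁.inv_hom_id
  have i₂ : ∀ x, e₁.inv.hom.hom (e₁.hom.hom.hom x) = x := fun x =>
    congrArg (fun k => k.hom.hom x) e₁.hom_inv_id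
  have i₃ : ∀ x, e₂.hom.hom.hom (e₂.inv.hom.hom x) = x := fun x =>
    congrArg (fun k => k.hom.hom x) e₂.inv_hom_id
  have i₄ : ∀ x, e₂.inv.hom.hom (e₂.hom.hom.hom x) = x := fun x =>
    congrArg (fun k => k.hom.hom x) e₂.hom_inv_id
  refine ⟨q ∘ₗ LinearMap.lcomp S B e₁.inv.hom.hom, ?_, ?_⟩
  · refine hq.comp fun φ => ⟨φ ∘ₗ e₁.hom.hom.hom, ?_⟩
    ext x
    exact congrArg φ (i₁ x)
  · intro φ
    refine (hqf _).trans ⟨?_, ?_⟩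
    · rintro ⟨ψ, hψ⟩
      refine ⟨ψ ∘ₗ e₂.hom.hom.hom, ?_⟩
      ext x
      have := LinearMap.congr_fun hψ (e₁.hom.hom.hom x)
      change ψ (f'.hom.hom (e₁.hom.hom.hom x)) = φ (e₁.inv.hom.hom (e₁.hom.hom.hom x)) at this
      rw [i₂, w'] at this
      exact this
    · rintro ⟨ψ, rfl⟩
      refine ⟨ψ ∘ₗ e₂.inv.hom.hom, ?_⟩
      ext x
      change ψ (e₂.inv.hom.hom (f'.hom.hom x)) = ψ (f.hom.hom (e₁.inv.hom.hom x))
      rw [← i₄ (f.hom.hom (e₁.inv.hom.hom x)), ← w', i₁]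

lemma exists_isDualCokernel (hB : IsBiregular R S B) {X Y : FGProj R} (f : X ⟶ Y) :
    ∃ N : FPMod S, IsDualCokernel B f N ∧
      N.obj = ModuleCat.of S ((X.obj →ₗ[R] B) ⧸ LinearMap.range (LinearMap.lcomp S B f.hom.hom)) := by
  obtain ⟨_, _⟩ := hB.finite_projective_dual X.obj
  obtain ⟨_, _⟩ := hB.finite_projective_dual Y.obj
  have := Module.finitePresentation_of_projective S (X.obj →ₗ[R] B)
  have := finitePresentation_quotient_range (LinearMap.lcomp S B f.hom.hom)
  exact ⟨fp _, ⟨Submodule.mkQ _, Submodule.mkQ_surjective _, LinearMap.exact_map_mkQ_range _⟩, rfl⟩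

open Abelian

/-- Since `g` is a weak cokernel, `N' = Y*/im g*` is isomorphic to `im f*`, giving a short exact
sequence `0 → N' → X* → N → 0` with projective middle term. Higher Ext groups shift. `Ext^1`
vanishes when every map `N' → B` extends to `X*`; by reflexivity such a map is an element `y` with
`g y = 0`, and an extension is an `x` with `f x = y`. -/
lemma IsDualCokernel.ext_iff [Abelian (FPMod S)] [HasExt.{v + 1} (FPMod S)]
    (hB : IsBiregular R S B) {X Y Z : FGProj R} {f : X ⟶ Y} {g : Y ⟶ Z} (h : IsWeakCokernel f g)
    {N N' : FPMod S} (hN : IsDualCokernel B f N) (hN' : IsDualCokernel B g N')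
    [hfp : Module.FinitePresentation S B] :
    (Subsingleton (Ext.{v + 1} N (fp B) 1) ↔ IsWeakKernel f g) ∧
    ∀ i, Subsingleton (Ext.{v + 1} N (fp B) (i + 2)) ↔
      Subsingleton (Ext.{v + 1} N' (fp B) (i + 1)) := by
  obtain ⟨q, hq, hqf⟩ := hN
  obtain ⟨q', hq', hqg⟩ := hN'
  obtain ⟨_, _⟩ := hB.finite_projective_dual X.obj
  have := Module.finitePresentation_of_projective S (X.obj →ₗ[R] B)
  have hex := h.dual_exact hB
  have hker : ∀ φ, q' φ = 0 ↔ LinearMap.lcomp S B f.hom.hom φ = 0 := fun φ =>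
    (hqg φ).trans (hex φ).symm
  obtain ⟨ι, hι⟩ : ∃ ι : N'.obj →ₗ[S] (X.obj →ₗ[R] B), ∀ φ, ι (q' φ) = φ ∘ₗ f.hom.hom :=
    exists_lift_of_surjective hq' _ fun φ hφ => (hker φ).1 hφ
  have hs : IsShortExact (fpHom (M := N') (N := fp (X.obj →ₗ[R] B)) ι)
      (fpHom (M := fp (X.obj →ₗ[R] B)) (N := N) q) := by
    refine FPMod.isShortExact _ _ ?_ ?_ hq
    · refine (injective_iff_map_eq_zero ι).2 fun y hy => ?_
      obtain ⟨φ, rfl⟩ := hq' y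
      rw [hι] at hy
      exact (hker φ).2 hy
    · intro φ
      refine (hqf φ).trans ⟨?_, ?_⟩
      · rintro ⟨ψ, rfl⟩
        exact ⟨q' ψ, hι ψ⟩
      · rintro ⟨y, rfl⟩
        obtain ⟨ψ, rfl⟩ := hq' y
        exact ⟨ψ, (hι ψ).symm⟩
  have : Projective (fp (R := S) (X.obj →ₗ[R] B)) := FPMod.projective_of_module_projective _
  refine ⟨?_, hs.subsingleton_ext_succ_iff _⟩
  rw [hs.subsingleton_ext_one_iff, FGProj.isWeakKernel_iff]
  constructor
  · intro H y
    constructor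
    · intro hy
      -- Evaluation at `y` kills the image of `g*` and so descends to `N'`. Its extension to `X*` is
      -- evaluation at some `x`, and functionals separate `f x` from `y` if they differ.
      let ev : (Y.obj →ₗ[R] B) →ₗ[S] B := LinearMap.applyₗ' S y
      obtain ⟨θ, hθ⟩ := exists_lift_of_surjective hq' ev fun φ hφ => by
        obtain ⟨ψ, rfl⟩ := (hqg φ).1 hφ
        change ψ (g.hom.hom y) = 0
        rw [hy, map_zero]
      obtain ⟨Ψ, hΨ⟩ := H (fpHom (M := N') (N := fp B) θ)
      obtain ⟨x, hx⟩ := hB.exists_eval Ψ.hom.hom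
      refine ⟨x, ?_⟩
      refine sub_eq_zero.1 (hB.dual_separates _ fun φ => ?_)
      have h1 : Ψ.hom.hom (ι (q' φ)) = θ (q' φ) := congrArg (fun k => k.hom.hom (q' φ)) hΨ
      rw [hι, hθ, hx] at h1
      rw [map_sub, sub_eq_zero]
      exact h1
    · rintro ⟨x, rfl⟩
      exact LinearMap.congr_fun ((FGProj.comp_eq_zero_iff f g).1
        ((h _ g).2 ⟨𝟙 _, Category.comp_id g⟩)) x
  · intro H θ
    obtain ⟨_, _⟩ := hB.finite_projective_dual Y.obj
    -- Conversely `θ` is evaluation at some `y`, which `g` kills because `q'` kills the image of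
    -- `g*`; a preimage of `y` under `f` provides the extension.
    obtain ⟨y, hy⟩ := hB.exists_eval (θ.hom.hom ∘ₗ q')
    have hgy : g.hom.hom y = 0 := hB.dual_separates _ fun φ => by
      rw [show φ (g.hom.hom y) = (LinearMap.lcomp S B g.hom.hom φ) y from rfl, ← hy]
      change θ.hom.hom (q' _) = 0
      rw [(hqg _).2 ⟨φ, rfl⟩, map_zero]
    obtain ⟨x, rfl⟩ := (H y).1 hgy
    refine ⟨fpHom (LinearMap.applyₗ' S x), ?_⟩
    ext z
    obtain ⟨φ, rfl⟩ := hq' z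
    refine Eq.trans ?_ (hy φ).symm
    change (ι (q' φ)) x = _
    rw [hι]
    rfl

end NAb

/-! ### (A2) and torsion freeness -/

namespace NAb

variable {R S : Type v} [Ring R] [Ring S] {B : Type v} [AddCommGroup B] [Module R B] [Module S B]
  [SMulCommClass R S B]

open Abelian

/-- Iterated dimension shifting: each step of `IsDualCokernel.ext_iff` lowers the Ext degree by one
and moves one place along the sequence. With `j = 0`, `Ext^(k+1)` measures exactness at `T_(k+1)`.
-/
lemma IsNCokernelSeq.ext_iff [Abelian (FPMod S)] [HasExt.{v + 1} (FPMod S)]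
    (hB : IsBiregular R S B) [Module.FinitePresentation S B] {n : ℕ}
    {T : ComposableArrows (FGProj R) (n + 1)} (hT : IsNCokernelSeq T) (k : ℕ) :
    ∀ (j m : ℕ) (hm : m = j + k) (h : m + 2 ≤ n + 1) (N : FPMod S)
      (_ : IsDualCokernel B (T.map' j (j + 1)) N),
      Subsingleton (Ext.{v + 1} N (fp B) (k + 1)) ↔
        IsWeakKernel (T.map' m (m + 1)) (T.map' (m + 1) (m + 2)) := by
  induction k with
  | zero =>
    intro j m hm h N hN
    obtain rfl : m = j := by simpa using hm
    obtain ⟨N', hN', -⟩ := exists_isDualCokernel hB (T.map' (m + 1) (m + 2))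
    exact (IsDualCokernel.ext_iff hB (hT.exact m h) hN hN').1
  | succ k ih =>
    rintro j m rfl h N hN
    obtain ⟨N', hN', -⟩ := exists_isDualCokernel hB (T.map' (j + 1) (j + 2))
    rw [(IsDualCokernel.ext_iff hB (hT.exact j (by omega)) hN hN').2]
    exact ih (j + 1) _ (by omega) h N' hN'

variable [hfp : Module.FinitePresentation S B]

/-- A monomorphism `f` is a projective resolution of its cokernel, which therefore has dimension at
most 1, and `N` is the transpose computed from this presentation. -/
lemma ext_subsingleton_of_mono [Abelian (FPMod R)] [Abelian (FPMod S)] {n : ℕ}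
    (h : ∀ M : FPMod R, HasProjectiveDimensionLE M 1 → IsTorsionFree (S := S) B n M)
    {X Y : FGProj R} (f : X ⟶ Y) (hf : Mono f) (N : FPMod S)
    (hN : N.obj =
      ModuleCat.of S ((X.obj →ₗ[R] B) ⧸ LinearMap.range (LinearMap.lcomp S B f.hom.hom))) :
    let := HasExt.standard (FPMod S)
    ∀ i, 1 ≤ i → i ≤ n → Subsingleton (Ext.{v + 1} N (fp B) i) := by
  rw [FGProj.mono_iff] at hf
  have := finitePresentation_quotient_range f.hom.hom
  have hpd : HasProjectiveDimensionLE
      (fp (R := R) (Y.obj ⧸ LinearMap.range f.hom.hom)) 1 :=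
    (FPMod.isShortExact_of_exact f.hom.hom (Submodule.mkQ _) hf
      (LinearMap.exact_map_mkQ_range _)
      (Submodule.mkQ_surjective _)).hasProjectiveDimensionLT_right 1
      (FPMod.hasProjectiveDimensionLT_of_projective _ 0)
      (FPMod.hasProjectiveDimensionLT_of_projective _ 1)
  have htr : IsTranspose B (fp (R := R) (Y.obj ⧸ LinearMap.range f.hom.hom)) N :=
    ⟨X, Y, f.hom.hom, ⟨LinearEquiv.refl _ _⟩, ⟨(eqToIso hN.symm).toLinearEquiv⟩⟩
  exact h _ hpd N htr

lemma isNKernelSeq_of_isTorsionFree [Abelian (FPMod R)] [Abelian (FPMod S)]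
    (hB : IsBiregular R S B) {n : ℕ}
    (h : ∀ M : FPMod R, HasProjectiveDimensionLE M 1 → IsTorsionFree (S := S) B n M)
    (T : ComposableArrows (FGProj R) (n + 1)) (hm : Mono (T.map' 0 1)) (hT : IsNCokernelSeq T) :
    IsNKernelSeq T := by
  let := HasExt.standard (FPMod S)
  obtain ⟨N, hN, hN'⟩ := exists_isDualCokernel hB (T.map' 0 1)
  have hv := ext_subsingleton_of_mono h (T.map' 0 1) hm N hN'
  refine ⟨(Preadditive.mono_iff_cancel_zero _).1 hm, fun i hi => ?_⟩
  exact (hT.ext_iff hB i 0 i (by omega) hi N hN).1 (hv (i + 1) (by omega) (by omega))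

lemma IsWeakCokernel.of_epi_comp {C : Type u} [Category.{v} C] [Preadditive C] {X I Y Z : C}
    {p : X ⟶ I} {ι : I ⟶ Y} {g : Y ⟶ Z} [Epi p] (h : IsWeakCokernel (p ≫ ι) g) :
    IsWeakCokernel ι g := by
  intro W k
  rw [← h W k, Category.assoc, ← cancel_epi p, comp_zero]

/-- The given presentation `f` of `M` need not be injective. As `M` has dimension at most 1, the
range of `f` is projective, so `f` factors as an epimorphism `p` followed by a monomorphism `ι` in
the category of projectives. (A2) applies to `ι`, and the Ext groups are compared through a common
weak cokernel `g` of `f` and `ι`. -/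
lemma isTorsionFree_of_isNKernelSeq [Abelian (FPMod R)] [Abelian (FPMod S)]
    (hB : IsBiregular R S B) {n : ℕ} (hn : 1 ≤ n)
    (h₁ : ∀ ⦃X Y : FGProj R⦄ (f : X ⟶ Y), HasNCokernel n f)
    (h₂ : ∀ T : ComposableArrows (FGProj R) (n + 1), Mono (T.map' 0 1) → IsNCokernelSeq T →
      IsNKernelSeq T)
    (M : FPMod R) (hM : HasProjectiveDimensionLE M 1) : IsTorsionFree (S := S) B n M := by
  let := HasExt.standard (FPMod S)
  rintro N ⟨P₁, P₀, f, ⟨e⟩, ⟨e'⟩⟩ i hi hin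
  have hN : IsDualCokernel B (fgpHom f : P₁ ⟶ P₀) N :=
    ⟨e'.toLinearMap ∘ₗ Submodule.mkQ _, e'.surjective.comp (Submodule.mkQ_surjective _), by
      intro φ
      refine Iff.trans ?_ (LinearMap.exact_map_mkQ_range _ φ)
      simp⟩
  have := finitePresentation_quotient_range f
  have : Module.FinitePresentation R (LinearMap.range f) := hasFPKernels_of_abelian.range f
  have hq : HasProjectiveDimensionLT (fp (P₀.obj ⧸ LinearMap.range f)) 2 := 
    FPMod.hasProjectiveDimensionLT_of_equiv (M := M.obj) e.symm 2
  have := FPMod.hasProjectiveDimensionLT_range f hq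
  have : Module.Projective R (LinearMap.range f) :=
    FPMod.module_projective (fp (LinearMap.range f))
  let p : P₁ ⟶ fgp (LinearMap.range f) := fgpHom f.rangeRestrict
  let ι : fgp (LinearMap.range f) ⟶ P₀ := fgpHom (LinearMap.range f).subtype
  have hp : Epi p := by
    have : Epi p.hom := (ModuleCat.epi_iff_surjective _).2 f.surjective_rangeRestrict
    exact (ObjectProperty.ι _).epi_of_epi_map this
  have hι : Mono ι := (FGProj.mono_iff _).2 Subtype.val_injective
  obtain ⟨n, rfl⟩ := Nat.exists_eq_succ_of_ne_zero (by omega : n ≠ 0)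
  obtain ⟨Z, g, hg, hgn⟩ := (hasNCokernel_iff _).1 (h₁ (fgpHom f : P₁ ⟶ P₀))
  have hg' : IsWeakCokernel ι g := IsWeakCokernel.of_epi_comp (p := p) hg
  have hιn : HasIteratedCokernel (n + 1) ι := ⟨Z, g, hg', hgn⟩
  obtain ⟨T, ⟨eT⟩, hT⟩ := hιn.hasNCokernel
  have hTm : Mono (T.map' 0 1) := by
    obtain ⟨e₁, e₂, w⟩ := exists_iso_of_arrow_iso eT
    have : T.map' 0 1 = e₁.hom ≫ ι ≫ e₂.inv := by
      rw [← Category.assoc]; exact (Iso.eq_comp_inv e₂).2 w.symm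
    rw [this]
    infer_instance
  have hTk := h₂ T hTm hT
  obtain ⟨Nι, hNι, -⟩ := exists_isDualCokernel hB ι
  obtain ⟨Ng, hNg, -⟩ := exists_isDualCokernel hB g
  have hv : ∀ k, k + 1 ≤ n + 1 → Subsingleton (Ext.{v + 1} Nι (fp B) (k + 1)) := fun k hk =>
    (hT.ext_iff hB k 0 k (by omega) (by omega) Nι (hNι.of_iso eT)).2 (hTk.exact k (by omega))
  obtain ⟨i, rfl⟩ := Nat.exists_eq_succ_of_ne_zero (by omega : i ≠ 0)
  have E₁ := IsDualCokernel.ext_iff hB hg hN hNg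
  have E₂ := IsDualCokernel.ext_iff hB hg' hNι hNg
  -- In degree 1 the criterion depends only on the range, which `f` and `ι` share; in higher degrees
  -- both sides shift to the same module `Ng`.
  cases i with
  | zero =>
    refine E₁.1.2 ?_
    have := E₂.1.1 (hv 0 hin)
    rw [FGProj.isWeakKernel_iff] at this ⊢
    intro y
    rw [this y]
    constructor
    · rintro ⟨⟨_, x, rfl⟩, rfl⟩
      exact ⟨x, rfl⟩
    · rintro ⟨x, rfl⟩
      exact ⟨⟨_, x, rfl⟩, rfl⟩
  | succ i => exact (E₁.2 i).2 ((E₂.2 i).1 (hv (i + 1) hin))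

end NAb

/-! ### Additive generators and the category of projectives -/

namespace NAb

section Generator

variable {C : Type u} [Category.{v} C] [Preadditive C]

/-- The identity of `Y` is a sum of morphisms factoring through `X`. -/
def IsGeneratedBy (X Y : C) : Prop :=
  ∃ (k : ℕ) (a : Fin k → (Y ⟶ X)) (b : Fin k → (X ⟶ Y)), ∑ i, a i ≫ b i = 𝟙 Y

lemma IsAdditiveGenerator.isGeneratedBy {X : C} (h : IsAdditiveGenerator X) (Y : C) :
    IsGeneratedBy X Y := by
  obtain ⟨k, b, ⟨hb⟩, ⟨r⟩⟩ := h Y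
  refine ⟨k, fun i => r.i ≫ b.π i, fun i => b.ι i ≫ r.r, ?_⟩
  have := IsBilimit.total hb
  change ∑ i, (r.i ≫ b.π i) ≫ b.ι i ≫ r.r = 𝟙 Y
  calc ∑ i, (r.i ≫ b.π i) ≫ b.ι i ≫ r.r = r.i ≫ (∑ i, b.π i ≫ b.ι i) ≫ r.r := by
        simp [Preadditive.sum_comp, Preadditive.comp_sum]
    _ = 𝟙 Y := by rw [this]; simp

lemma isAdditiveGenerator_of_isGeneratedBy [HasFiniteBiproducts C] {X : C}
    (h : ∀ Y, IsGeneratedBy X Y) : IsAdditiveGenerator X := by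
  intro Y
  obtain ⟨k, a, b, hab⟩ := h Y
  refine ⟨k, biproduct.bicone _, ⟨biproduct.isBilimit _⟩,
    ⟨⟨biproduct.lift a, biproduct.desc b, ?_⟩⟩⟩
  rw [biproduct.lift_desc, hab]

end Generator

section FGProj

variable {R : Type v} [Ring R]

instance : HasFiniteBiproducts (FGProj R) := by
  let P : ObjectProperty (ModuleCat.{v} R) := fun P => Module.Finite R P ∧ Module.Projective R P
  have : P.IsClosedUnderIsomorphisms := ⟨fun e ⟨_, _⟩ =>
    ⟨Module.Finite.equiv e.toLinearEquiv, Module.Projective.of_equiv e.toLinearEquiv⟩⟩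
  have : P.IsClosedUnderFiniteProducts := isClosedUnderFiniteProducts_of_pi P
    (fun J _ M hM => by
      have : ∀ j, Module.Finite R (M j) := fun j => (hM j).1
      have : ∀ j, Module.Projective R (M j) := fun j => (hM j).2
      have := Fintype.ofFinite J
      classical
      exact ⟨(inferInstance : Module.Finite R (∀ j, M j)),
        Module.Projective.of_equiv (DFinsupp.linearEquivFunOnFintype (R := R) (M := fun j => M j))⟩)
  have : HasFiniteProducts P.FullSubcategory := inferInstance
  exact HasFiniteBiproducts.of_hasFiniteProducts

instance : IsIdempotentComplete (FGProj R) where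
  idempotents_split X p hp := by
    have h : ∀ x, p.hom.hom (p.hom.hom x) = p.hom.hom x := fun x =>
      congrArg (fun k => k.hom.hom x) hp
    have hs : p.hom.hom.rangeRestrict ∘ₗ (LinearMap.range p.hom.hom).subtype = LinearMap.id := by
      ext ⟨_, x, rfl⟩
      exact h x
    have : Module.Projective R (LinearMap.range p.hom.hom) := Module.Projective.of_split _ _ hs
    refine ⟨fgp (LinearMap.range p.hom.hom), fgpHom (LinearMap.range p.hom.hom).subtype,
      fgpHom p.hom.hom.rangeRestrict, ?_, ?_⟩
    · ext x
      exact congrArg Subtype.val (LinearMap.congr_fun hs x)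
    · ext x
      rfl

lemma FGProj.isGeneratedBy_of_equiv {B : Type v} [AddCommGroup B] [Module R B]
    [Module.Finite R B] [Module.Projective R B] (e : R ≃ₗ[R] B) (P : FGProj R) :
    IsGeneratedBy (fgp B) P := by
  obtain ⟨k, x, f, hf⟩ := exists_dual_basis (R := R) (P := P.obj)
  refine ⟨k, fun i => fgpHom (e.toLinearMap ∘ₗ f i),
    fun i => fgpHom (LinearMap.toSpanSingleton R P.obj (x i) ∘ₗ e.symm.toLinearMap), ?_⟩
  ext p
  have hsum : ∀ (t : Finset (Fin k)) (φ : Fin k → (P ⟶ P)),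
      (∑ i ∈ t, φ i).hom.hom p = ∑ i ∈ t, (φ i).hom.hom p := fun t φ =>
    map_sum (AddMonoidHom.mk' (fun g : P ⟶ P => g.hom.hom p) fun _ _ => rfl) φ t
  refine (hsum _ _).trans (Eq.trans (Finset.sum_congr rfl fun i _ => ?_) (hf p).symm)
  change e.symm (e (f i p)) • x i = _
  simp

end FGProj

/-! ### The duality functor is an equivalence -/

section Duality

variable {R S : Type v} [Ring R] [Ring S] {B : Type v} [AddCommGroup B] [Module R B] [Module S B]
  [SMulCommClass R S B]

/-- The duality `Hom(-, B)` from projective `R`-modules to projective `S`-modules. -/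
def dualFunctor (hB : IsBiregular R S B) : (FGProj R)ᵒᵖ ⥤ FGProj S where
  obj P := ⟨ModuleCat.of S (P.unop.obj →ₗ[R] B), hB.finite_projective_dual P.unop.obj⟩
  map f := ObjectProperty.homMk (ModuleCat.ofHom (LinearMap.lcomp S B f.unop.hom.hom))

instance (hB : IsBiregular R S B) : (dualFunctor hB).Additive where
  map_add {X Y f g} := by
    ext φ
    let ψ : X.unop.obj →ₗ[R] B := φ
    refine LinearMap.ext fun x => ?_
    exact map_add ψ _ _

instance (hB : IsBiregular R S B) : (dualFunctor hB).Faithful where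
  map_injective {X Y f g} h := by
    apply Quiver.Hom.unop_inj
    ext x
    refine sub_eq_zero.1 (hB.dual_separates _ fun φ => ?_)
    have := LinearMap.congr_fun (congrArg (fun k => k.hom.hom φ) h) x
    rw [map_sub, sub_eq_zero]
    exact this

instance (hB : IsBiregular R S B) : (dualFunctor hB).Full where
  map_surjective {X Y} G := by
    let G' : (X.unop.obj →ₗ[R] B) →ₗ[S] (Y.unop.obj →ₗ[R] B) := G.hom.hom
    -- Applying `G` and evaluating at `y` is a functional on the dual of `X`, hence evaluation at
    -- some `x`. Since functionals separate points, `y ↦ x` is linear.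
    have hex : ∀ y : Y.unop.obj, ∃ x : X.unop.obj, ∀ φ, G' φ y = φ x := fun y =>
      hB.exists_eval (LinearMap.applyₗ' S y ∘ₗ G')
    choose f hf using hex
    have hadd : ∀ x y, f (x + y) = f x + f y := fun x y => by
      refine sub_eq_zero.1 (hB.dual_separates _ fun φ => ?_)
      rw [map_sub, map_add, ← hf, ← hf, ← hf, map_add, sub_self]
    have hsmul : ∀ (r : R) x, f (r • x) = r • f x := fun r x => by
      refine sub_eq_zero.1 (hB.dual_separates _ fun φ => ?_)
      rw [map_sub, map_smul, ← hf, ← hf, map_smul, sub_self]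
    refine ⟨Quiver.Hom.op (fgpHom { toFun := f, map_add' := hadd, map_smul' := hsmul }), ?_⟩
    ext φ
    refine LinearMap.ext fun y => (hf y φ).symm

instance (hB : IsBiregular R S B) : (dualFunctor hB).EssSurj where
  mem_essImage N := by
    have := SMulCommClass.symm R S B
    obtain ⟨_, _⟩ := hB.symm.finite_projective_dual N.obj
    let ev : N.obj →ₗ[S] ((N.obj →ₗ[S] B) →ₗ[R] B) :=
      { toFun := fun x => LinearMap.applyₗ' R x
        map_add' := fun x y => by ext φ; exact map_add φ x y
        map_smul' := fun s x => by ext φ; exact map_smul φ s x }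
    have hev : Function.Bijective ev := by
      constructor
      · refine (injective_iff_map_eq_zero ev).2 fun x hx => ?_
        exact hB.symm.dual_separates x fun φ => LinearMap.congr_fun hx φ
      · intro Ψ
        obtain ⟨x, hx⟩ := hB.symm.exists_eval Ψ
        exact ⟨x, LinearMap.ext fun φ => (hx φ).symm⟩
    exact ⟨Opposite.op (fgp (N.obj →ₗ[S] B)),
      ⟨ObjectProperty.isoMk _ (LinearEquiv.ofBijective ev hev).symm.toModuleIso⟩⟩

instance (hB : IsBiregular R S B) : (dualFunctor hB).IsEquivalence where

end Duality

/-! ### The ring axioms match the axioms of `n`-abelian categories -/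

section Rings

variable (Λ : Type v) [Ring Λ]

lemma isBiregular_mulOpposite_self : IsBiregular Λᵐᵒᵖ Λ Λ :=
  ⟨1, by
    refine ⟨fun a b h => ?_, fun a => ⟨MulOpposite.op a, by simp⟩⟩
    exact MulOpposite.unop_injective (by simpa using h), by
    refine ⟨fun a b h => by simpa using h, fun a => ⟨a, by simp⟩⟩⟩

variable {Λ}

lemma SatisfiesR.isNAbelian {n : ℕ} (hn : 1 ≤ n) (h : SatisfiesR n Λ) :
    IsNAbelian n (FGProj Λᵐᵒᵖ) := by
  obtain ⟨_, _, h₁, h₁', h₂, h₂'⟩ := h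
  have hB := isBiregular_mulOpposite_self Λ
  have H : HasNKernelAxioms n (FGProj Λᵐᵒᵖ) :=
    ⟨hasNKernel_of_globalDimensionLE hn h₁, isNKernelSeq_of_isTorsionFree hB h₂⟩
  have H' : HasNKernelAxioms n (FGProj Λ) :=
    ⟨hasNKernel_of_globalDimensionLE hn h₁', isNKernelSeq_of_isTorsionFree hB.symm h₂'⟩
  refine IsNAbelian.of_hasNKernelAxioms H ?_
  have : (dualFunctor hB).asEquivalence.functor.Additive :=
    (inferInstance : (dualFunctor hB).Additive)
  have : (dualFunctor hB).asEquivalence.symm.functor.Additive :=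
    (dualFunctor hB).asEquivalence.inverse_additive
  exact HasNKernelAxioms.of_equivalence (dualFunctor hB).asEquivalence.symm H'

lemma satisfiesR_of_isNAbelian {n : ℕ} (hn : 1 ≤ n) (h : IsNAbelian n (FGProj Λᵐᵒᵖ)) :
    SatisfiesR n Λ := by
  have hB := isBiregular_mulOpposite_self Λ
  have H := h.hasNKernelAxioms
  have : (dualFunctor hB).asEquivalence.functor.Additive :=
    (inferInstance : (dualFunctor hB).Additive)
  have H' : HasNKernelAxioms n (FGProj Λ) :=
    HasNKernelAxioms.of_equivalence (dualFunctor hB).asEquivalence h.hasNKernelAxioms_op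
  have : (dualFunctor hB.symm).asEquivalence.functor.Additive :=
    (inferInstance : (dualFunctor hB.symm).Additive)
  have h' : IsNAbelian n (FGProj Λ) := IsNAbelian.of_hasNKernelAxioms H' (by
    have : (dualFunctor hB.symm).asEquivalence.symm.functor.Additive :=
      (dualFunctor hB.symm).asEquivalence.inverse_additive
    exact HasNKernelAxioms.of_equivalence (dualFunctor hB.symm).asEquivalence.symm H)
  obtain ⟨_⟩ := abelian_of_hasFPKernels (hasFPKernels_of_hasNKernel hn H.a1)
  obtain ⟨_⟩ := abelian_of_hasFPKernels (hasFPKernels_of_hasNKernel hn H'.a1)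
  exact ⟨‹_›, ‹_›, globalDimensionLE_of_hasNKernel H.a1, globalDimensionLE_of_hasNKernel H'.a1,
    isTorsionFree_of_isNKernelSeq hB hn h.a1_op h.a2,
    isTorsionFree_of_isNKernelSeq hB.symm hn h'.a1_op h'.a2⟩

end Rings

end NAb

/-! ### A category with an additive generator is a category of projectives -/

namespace NAb

section HomFunctor

variable {C : Type u} [Category.{v} C] [Preadditive C] {X : C}

lemma op_smul_hom {X Y : C} (r : (End X)ᵐᵒᵖ) (h : X ⟶ Y) : r • h = r.unop ≫ h := rfl

lemma IsGeneratedBy.eq_sum_comp {Y : C} {k : ℕ} {a : Fin k → (Y ⟶ X)} {b : Fin k → (X ⟶ Y)}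
    (hab : ∑ i, a i ≫ b i = 𝟙 Y) (h : X ⟶ Y) : h = ∑ i, h ≫ a i ≫ b i := by
  rw [← Preadditive.comp_sum, hab, Category.comp_id]

lemma IsGeneratedBy.finite_projective {Y : C} (h : IsGeneratedBy X Y) :
    Module.Finite (End X)ᵐᵒᵖ (X ⟶ Y) ∧ Module.Projective (End X)ᵐᵒᵖ (X ⟶ Y) := by
  obtain ⟨k, a, b, hab⟩ := h
  let s : (X ⟶ Y) →ₗ[(End X)ᵐᵒᵖ] (Fin k → (End X)ᵐᵒᵖ) :=
    { toFun := fun h i => MulOpposite.op (h ≫ a i)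
      map_add' := fun h h' => by ext i; simp
      map_smul' := fun r h => by
        funext i
        apply MulOpposite.unop_injective
        exact Category.assoc _ _ _ }
  let p : (Fin k → (End X)ᵐᵒᵖ) →ₗ[(End X)ᵐᵒᵖ] (X ⟶ Y) := Fintype.linearCombination _ b
  have hps : p ∘ₗ s = LinearMap.id := by
    ext h
    change p (s h) = h
    rw [Fintype.linearCombination_apply]
    conv_rhs => rw [IsGeneratedBy.eq_sum_comp hab h]
    exact Finset.sum_congr rfl fun i _ => Category.assoc _ _ _
  exact ⟨Module.Finite.of_surjective p fun h => ⟨s h, LinearMap.congr_fun hps h⟩,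
    Module.Projective.of_split s p hps⟩

/-- The functor `Hom(X, -)` to finitely generated projective modules over the endomorphism ring
of `X`. -/
def homFunctor (h : ∀ Y, IsGeneratedBy X Y) : C ⥤ FGProj (End X)ᵐᵒᵖ :=
  ObjectProperty.lift _ (preadditiveCoyonedaObj X) fun Y => (h Y).finite_projective

variable (h : ∀ Y, IsGeneratedBy X Y)

instance : (homFunctor h).Additive where
  map_add {Y Z f g} := by
    ext k
    exact Preadditive.comp_add _ _ _ k f g

instance : (homFunctor h).Faithful where
  map_injective {Y Z f g} hfg := by
    obtain ⟨k, a, b, hab⟩ := h Y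
    have hb : ∀ i, b i ≫ f = b i ≫ g := fun i => congrArg (fun q => q.hom.hom (b i)) hfg
    rw [← Category.id_comp f, ← Category.id_comp g, ← hab, Preadditive.sum_comp,
      Preadditive.sum_comp]
    exact Finset.sum_congr rfl fun i _ => by rw [Category.assoc, hb, Category.assoc]

instance : (homFunctor h).Full where
  map_surjective {Y Z} G := by
    obtain ⟨k, a, b, hab⟩ := h Y
    let G' : (X ⟶ Y) →ₗ[(End X)ᵐᵒᵖ] (X ⟶ Z) := G.hom.hom
    -- Each `l` is the combination of the `b i` with coefficients `l ≫ a i` in `End X`, so linearity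
    -- determines `G'` by its values on the `b i`.
    have key : ∀ l : X ⟶ Y, l ≫ (∑ i, a i ≫ G' (b i)) = G' l := fun l => by
      conv_rhs => rw [IsGeneratedBy.eq_sum_comp hab l, map_sum]
      rw [Preadditive.comp_sum]
      refine Finset.sum_congr rfl fun i _ => ?_
      have := G'.map_smul (MulOpposite.op (l ≫ a i : End X)) (b i)
      rw [op_smul_hom, op_smul_hom] at this
      simpa using this.symm
    exact ⟨∑ i, a i ≫ G' (b i), ObjectProperty.hom_ext _ (ModuleCat.hom_ext (LinearMap.ext key))⟩

instance [HasFiniteBiproducts C] [IsIdempotentComplete C] : (homFunctor h).EssSurj where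
  mem_essImage P := by
    let e : (End X)ᵐᵒᵖ ≃ₗ[(End X)ᵐᵒᵖ] (X ⟶ X) :=
      { toFun := fun r => r.unop
        invFun := MulOpposite.op
        left_inv := fun _ => rfl
        right_inv := fun _ => rfl
        map_add' := fun _ _ => rfl
        map_smul' := fun r s => rfl }
    obtain ⟨_, _⟩ := (h X).finite_projective
    obtain ⟨k, a, b, hab⟩ : IsGeneratedBy ((homFunctor h).obj X) P :=
      FGProj.isGeneratedBy_of_equiv e P
    let Y₀ : C := biproduct fun _ : Fin k => X
    let i : P ⟶ (homFunctor h).obj Y₀ :=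
      ∑ j, a j ≫ (homFunctor h).map (biproduct.ι (fun _ : Fin k => X) j)
    let r : (homFunctor h).obj Y₀ ⟶ P :=
      ∑ j, (homFunctor h).map (biproduct.π (fun _ : Fin k => X) j) ≫ b j
    have hir : i ≫ r = 𝟙 P := by
      rw [← hab]
      simp only [i, r, Preadditive.sum_comp, Preadditive.comp_sum, Category.assoc]
      refine Finset.sum_congr rfl fun j _ => ?_
      rw [Finset.sum_eq_single j]
      · rw [← Category.assoc ((homFunctor h).map _), ← Functor.map_comp, biproduct.ι_π_self]
        simp
      · intro l _ hl
        rw [← Category.assoc ((homFunctor h).map _), ← Functor.map_comp,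
          biproduct.ι_π_ne _ hl]
        simp
      · simp
    -- `P` is a retract of the image of `X^k`. The corresponding idempotent comes from an idempotent
    -- of `X^k`, whose splitting in `C` is the preimage of `P`.
    obtain ⟨p, hp⟩ := (homFunctor h).map_surjective (r ≫ i)
    have hpp : p ≫ p = p := (homFunctor h).map_injective (by
      rw [Functor.map_comp, hp, Category.assoc, reassoc_of% hir])
    obtain ⟨Y, j, q, hjq, hqj⟩ := IsIdempotentComplete.idempotents_split _ p hpp
    refine ⟨Y, ⟨⟨(homFunctor h).map j ≫ r, i ≫ (homFunctor h).map q, ?_, ?_⟩⟩⟩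
    · rw [Category.assoc, ← Category.assoc r, ← hp, ← Functor.map_comp, ← Functor.map_comp, ← hqj]
      simp [hjq]
    · rw [Category.assoc, ← Functor.map_comp_assoc, hqj, hp]
      simp [hir]

instance [HasFiniteBiproducts C] [IsIdempotentComplete C] : (homFunctor h).IsEquivalence where

end HomFunctor

end NAb

/-! ### Morita invariance: modules over `End X` as additive presheaves -/

namespace NAb

section Evaluation

variable {C : Type u} [Category.{v} C] [Preadditive C] (X : C)

/-- The value at `X` of an additive presheaf is a right module over the endomorphism ring. -/
abbrev evaluationModule (F : Cᵒᵖ ⥤+ AddCommGrpCat.{v}) :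
    Module (End X)ᵐᵒᵖ (F.obj.obj (Opposite.op X)) where
  smul r x := F.obj.map (Quiver.Hom.op r.unop) x
  one_smul x := congrArg (fun k => k.hom x) (F.obj.map_id _)
  mul_smul r s x := congrArg (fun k => k.hom x) (F.obj.map_comp (Quiver.Hom.op s.unop)
    (Quiver.Hom.op r.unop))
  smul_zero r := map_zero (F.obj.map (Quiver.Hom.op r.unop)).hom
  smul_add r := map_add (F.obj.map (Quiver.Hom.op r.unop)).hom
  add_smul r s x := congrArg (fun k => k.hom x)
    (F.obj.map_add (f := Quiver.Hom.op r.unop) (g := Quiver.Hom.op s.unop))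
  zero_smul x := congrArg (fun k => k.hom x)
    (F.obj.map_zero (Opposite.op X) (Opposite.op X))

/-- Evaluation of additive presheaves at `X`. -/
def evaluationFunctor : (Cᵒᵖ ⥤+ AddCommGrpCat.{v}) ⥤ ModuleCat.{v} (End X)ᵐᵒᵖ where
  obj F := letI := evaluationModule X F; ModuleCat.of _ (F.obj.obj (Opposite.op X))
  map {F G} α :=
    letI := evaluationModule X F
    letI := evaluationModule X G
    ModuleCat.ofHom
      { toFun := (α.hom.app (Opposite.op X)).hom
        map_add' := map_add (α.hom.app (Opposite.op X)).hom
        map_smul' := fun r x =>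
          congrArg (fun k => k.hom x) (α.hom.naturality (Quiver.Hom.op r.unop)) }

variable {X}

/-- The restriction map of an additive presheaf. -/
def restrict (F : Cᵒᵖ ⥤+ AddCommGrpCat.{v}) {Y Z : C} (f : Y ⟶ Z) :
    F.obj.obj (Opposite.op Z) →+ F.obj.obj (Opposite.op Y) :=
  (F.obj.map f.op).hom

lemma restrict_comp (F : Cᵒᵖ ⥤+ AddCommGrpCat.{v}) {Y Z W : C} (f : Y ⟶ Z) (g : Z ⟶ W)
    (x : F.obj.obj (Opposite.op W)) : restrict F (f ≫ g) x = restrict F f (restrict F g x) :=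
  congrArg (fun k => k.hom x) (F.obj.map_comp g.op f.op)

lemma restrict_id (F : Cᵒᵖ ⥤+ AddCommGrpCat.{v}) {Y : C} (x : F.obj.obj (Opposite.op Y)) :
    restrict F (𝟙 Y) x = x :=
  congrArg (fun k => k.hom x) (F.obj.map_id _)

lemma restrict_sum (F : Cᵒᵖ ⥤+ AddCommGrpCat.{v}) {Y Z : C} {k : ℕ} (f : Fin k → (Y ⟶ Z))
    (x : F.obj.obj (Opposite.op Z)) : restrict F (∑ i, f i) x = ∑ i, restrict F (f i) x :=
  map_sum (AddMonoidHom.mk' (fun g : Y ⟶ Z => restrict F g x) fun g g' =>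
    congrArg (fun k => k.hom x) (F.obj.map_add (f := g.op) (g := g'.op))) f _

lemma restrict_eq_sum (F : Cᵒᵖ ⥤+ AddCommGrpCat.{v}) {Y : C} {k : ℕ} {a : Fin k → (Y ⟶ X)}
    {b : Fin k → (X ⟶ Y)} (hab : ∑ i, a i ≫ b i = 𝟙 Y) (y : F.obj.obj (Opposite.op Y)) :
    y = ∑ i, restrict F (a i) (restrict F (b i) y) := by
  conv_lhs => rw [← restrict_id F y, ← hab, restrict_sum]
  exact Finset.sum_congr rfl fun i _ => restrict_comp F _ _ _

lemma IsGeneratedBy.eq_of_restrict_eq {Y : C} (h : IsGeneratedBy X Y)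
    (F : Cᵒᵖ ⥤+ AddCommGrpCat.{v}) {y z : F.obj.obj (Opposite.op Y)}
    (hyz : ∀ g : X ⟶ Y, restrict F g y = restrict F g z) : y = z := by
  obtain ⟨k, a, b, hab⟩ := h
  rw [restrict_eq_sum F hab y, restrict_eq_sum F hab z]
  exact Finset.sum_congr rfl fun i _ => by rw [hyz]

/-- An element of `F(Y)` is rebuilt from its restrictions along the `b i`, which lie in `F(X)`; this
dictates the formula for `ψ`. -/
lemma IsGeneratedBy.exists_extension {Y : C} (h : IsGeneratedBy X Y)
    {F G : Cᵒᵖ ⥤+ AddCommGrpCat.{v}}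
    (φ : F.obj.obj (Opposite.op X) →+ G.obj.obj (Opposite.op X))
    (hφ : ∀ (g : X ⟶ X) x, φ (restrict F g x) = restrict G g (φ x)) :
    ∃ ψ : F.obj.obj (Opposite.op Y) →+ G.obj.obj (Opposite.op Y),
      ∀ (g : X ⟶ Y) y, restrict G g (ψ y) = φ (restrict F g y) := by
  obtain ⟨k, a, b, hab⟩ := h
  refine ⟨∑ i, (restrict G (a i)).comp (φ.comp (restrict F (b i))), fun g y => ?_⟩
  conv_rhs => rw [restrict_eq_sum F hab y]
  simp only [AddMonoidHom.finsetSum_apply, AddMonoidHom.comp_apply, map_sum]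
  exact Finset.sum_congr rfl fun i _ => by rw [← restrict_comp, ← restrict_comp F, hφ]

lemma evaluationFunctor_faithful (h : ∀ Y, IsGeneratedBy X Y) :
    (evaluationFunctor X).Faithful where
  map_injective {F G α β} hαβ := by
    have h1 : ∀ x, (α.hom.app (Opposite.op X)).hom x = (β.hom.app (Opposite.op X)).hom x :=
      fun x => congrArg (fun k => k.hom x) hαβ
    apply ObjectProperty.hom_ext
    ext ⟨Y⟩ y
    refine (h Y).eq_of_restrict_eq G fun g => ?_
    have hα : restrict G g ((α.hom.app (Opposite.op Y)).hom y) =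
      (α.hom.app (Opposite.op X)).hom (restrict F g y) :=
      (congrArg (fun k => k.hom y) (α.hom.naturality g.op)).symm
    have hβ : restrict G g ((β.hom.app (Opposite.op Y)).hom y) =
      (β.hom.app (Opposite.op X)).hom (restrict F g y) :=
      (congrArg (fun k => k.hom y) (β.hom.naturality g.op)).symm
    exact hα.trans ((h1 _).trans hβ.symm)

lemma evaluationFunctor_full (h : ∀ Y, IsGeneratedBy X Y) : (evaluationFunctor X).Full where
  map_surjective {F G} φ := by
    let _ := evaluationModule X F
    let _ := evaluationModule X G
    let φ' : F.obj.obj (Opposite.op X) →ₗ[(End X)ᵐᵒᵖ] G.obj.obj (Opposite.op X) := φ.hom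
    choose ψ hψ using fun Y => (h Y).exists_extension φ'.toAddMonoidHom
      (fun g x => φ'.map_smul (MulOpposite.op g) x)
    refine ⟨ObjectProperty.homMk
      { app := fun Y => AddCommGrpCat.ofHom (ψ Y.unop)
        naturality := fun Y Z f => ?_ }, ?_⟩
    · ext y
      refine (h Z.unop).eq_of_restrict_eq G fun g => ?_
      have e1 := hψ Z.unop g (restrict F f.unop y)
      have e2 := hψ Y.unop (g ≫ f.unop) y
      rw [restrict_comp, restrict_comp] at e2
      exact e1.trans e2.symm
    · have e1 : ∀ x, ψ X x = φ' x := fun x => by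
        have e1 := hψ X (𝟙 X) x
        rw [restrict_id, restrict_id] at e1
        exact e1
      exact ModuleCat.hom_ext (LinearMap.ext e1)

/-- The additive presheaf of linear maps from `Hom(X, -)` to a module. -/
def homPresheaf (M : ModuleCat.{v} (End X)ᵐᵒᵖ) : Cᵒᵖ ⥤+ AddCommGrpCat.{v} where
  obj :=
    { obj := fun Y => AddCommGrpCat.of ((X ⟶ Y.unop) →ₗ[(End X)ᵐᵒᵖ] M)
      map := fun f => AddCommGrpCat.ofHom
        { toFun := fun φ => φ ∘ₗ ((preadditiveCoyonedaObj X).map f.unop).hom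
          map_zero' := rfl
          map_add' := fun _ _ => rfl }
      map_id := fun Y => by
        refine AddCommGrpCat.ext fun (φ : (X ⟶ Y.unop) →ₗ[(End X)ᵐᵒᵖ] M) => ?_
        exact LinearMap.ext fun x => congrArg φ (Category.comp_id x)
      map_comp := fun {Y _ _} f g => by
        refine AddCommGrpCat.ext fun (φ : (X ⟶ Y.unop) →ₗ[(End X)ᵐᵒᵖ] M) => ?_
        exact LinearMap.ext fun x => congrArg φ (Category.assoc _ _ _).symm }
  property := by
    constructor
    intro Y Z f g
    refine AddCommGrpCat.ext fun (φ : (X ⟶ Y.unop) →ₗ[(End X)ᵐᵒᵖ] M) => ?_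
    exact LinearMap.ext fun x =>
      (congrArg φ (Preadditive.comp_add _ _ _ _ _ _)).trans (map_add φ _ _)

/-- The value of `homPresheaf M` at `X` consists of the linear maps from `End X` to `M`, which are
determined by the image of the identity. -/
lemma evaluationFunctor_essSurj : (evaluationFunctor X).EssSurj where
  mem_essImage M := by
    refine ⟨homPresheaf M, ⟨LinearEquiv.toModuleIso ?_⟩⟩
    letI := evaluationModule X (homPresheaf M)
    exact
      { toFun := fun φ => (show (X ⟶ X) →ₗ[(End X)ᵐᵒᵖ] M from φ) (𝟙 X)
        map_add' := fun _ _ => rfl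
        map_smul' := fun r φ => by
          let φ' : (X ⟶ X) →ₗ[(End X)ᵐᵒᵖ] M := φ
          change φ' (𝟙 X ≫ r.unop) = r • φ' (𝟙 X)
          rw [← map_smul, op_smul_hom, Category.id_comp, Category.comp_id]
        invFun := fun m => LinearMap.toSpanSingleton (End X)ᵐᵒᵖ M m ∘ₗ
          { toFun := fun g : X ⟶ X => (MulOpposite.op g : (End X)ᵐᵒᵖ)
            map_add' := fun _ _ => rfl
            map_smul' := fun _ _ => rfl }
        left_inv := fun φ => by
          let φ' : (X ⟶ X) →ₗ[(End X)ᵐᵒᵖ] M := φ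
          refine LinearMap.ext fun g => ?_
          change (MulOpposite.op g : (End X)ᵐᵒᵖ) • φ' (𝟙 X) = φ' g
          rw [← map_smul, op_smul_hom]
          exact congrArg φ' (Category.comp_id g)
        right_inv := fun m => one_smul _ m }

lemma evaluationFunctor_isEquivalence (h : ∀ Y, IsGeneratedBy X Y) :
    (evaluationFunctor X).IsEquivalence :=
  have := evaluationFunctor_faithful h
  have := evaluationFunctor_full h
  have := evaluationFunctor_essSurj (X := X)
  { }

end Evaluation

open scoped ModuleCat.Algebra

/-- An equivalence preserves binary products, so it is additive, and additive functors are
automatically compatible with integer scalars. -/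
lemma isMoritaEquivalent_of_equivalence {A B : Type v} [Ring A] [Ring B] [Algebra ℤ A]
    [Algebra ℤ B] (e : ModuleCat.{v} A ≌ ModuleCat.{v} B) : IsMoritaEquivalent ℤ A B := by
  have : e.functor.Additive := e.functor.additive_of_preserves_binary_products
  refine ⟨⟨{ eqv := e, linear := ?_ }⟩⟩
  refine (@Functor.linear_iff ℤ _ (ModuleCat.{v} A) (ModuleCat.{v} B) _ _ _ _
    ModuleCat.Algebra.instLinear ModuleCat.Algebra.instLinear e.functor).2 fun M r => ?_
  have h := @map_intCast_smul _ _ _ _ _ _ _ (e.functor.mapAddHom (X := M) (Y := M)) ℤ ℤ _ _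
    (ModuleCat.Algebra.instLinear.homModule M M)
    (ModuleCat.Algebra.instLinear.homModule (e.functor.obj M) (e.functor.obj M)) r (𝟙 M)
  simp only [Int.cast_id] at h
  exact h.trans (congrArg _ (e.functor.map_id M))

lemma isMoritaEquivalent_of_ringEquiv {A B : Type v} [Ring A] [Ring B] [Algebra ℤ A]
    [Algebra ℤ B] (e : A ≃+* B) : IsMoritaEquivalent ℤ A B :=
  .of_algEquiv ℤ (AlgEquiv.ofRingEquiv (f := e) fun r => by simp)

/-- Two additive generators have Morita equivalent endomorphism rings. -/
lemma isMoritaEquivalent_end {C : Type u} [Category.{v} C] [Preadditive C] {X Y : C}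
    [Algebra ℤ (End X)ᵐᵒᵖ] [Algebra ℤ (End Y)ᵐᵒᵖ] (hX : ∀ Z, IsGeneratedBy X Z)
    (hY : ∀ Z, IsGeneratedBy Y Z) :
    IsMoritaEquivalent ℤ (End X)ᵐᵒᵖ (End Y)ᵐᵒᵖ := by
  have := evaluationFunctor_isEquivalence hX
  have := evaluationFunctor_isEquivalence hY
  exact isMoritaEquivalent_of_equivalence
    ((evaluationFunctor X).asEquivalence.symm.trans (evaluationFunctor Y).asEquivalence)

/-! ### Morita equivalence and projective modules -/

lemma isCompactElement_map {α : Type*} {β : Type*} [PartialOrder α] [PartialOrder β] (e : α ≃o β)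
    {a : α} (h : IsCompactElement a) : IsCompactElement (e a) := by
  intro s u hs hd hu ha
  obtain ⟨x, hx, hax⟩ := h (e.symm '' s) (e.symm u) (hs.image _)
    (by
      rintro _ ⟨x, hx, rfl⟩ _ ⟨y, hy, rfl⟩
      obtain ⟨z, hz, h1, h2⟩ := hd x hx y hy
      exact ⟨_, ⟨z, hz, rfl⟩, e.symm.monotone h1, e.symm.monotone h2⟩)
    (e.symm.isLUB_image'.2 hu) (by rwa [e.le_symm_apply])
  obtain ⟨y, hy, rfl⟩ := hx
  exact ⟨y, hy, by rwa [← e.le_symm_apply]⟩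

lemma isCompactElement_map_iff {α : Type*} {β : Type*} [PartialOrder α] [PartialOrder β]
    (e : α ≃o β) (a : α) : IsCompactElement (e a) ↔ IsCompactElement a :=
  ⟨fun h => by simpa using isCompactElement_map e.symm h, isCompactElement_map e⟩

/-- Expresses finite generation through the subobject lattice, which any equivalence of categories
preserves. -/
lemma finite_iff_isCompactElement_top {A : Type v} [Ring A] (M : ModuleCat.{v} A) :
    Module.Finite A M ↔ IsCompactElement (⊤ : Subobject M) := by
  rw [Module.finite_def, Submodule.fg_iff_compact, ← (ModuleCat.subobjectModule M).map_top,
    isCompactElement_map_iff]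

lemma finite_functor_obj_iff {A B : Type v} [Ring A] [Ring B]
    (e : ModuleCat.{v} A ≌ ModuleCat.{v} B) (P : ModuleCat.{v} A) :
    Module.Finite B (e.functor.obj P) ↔ Module.Finite A P := by
  rw [finite_iff_isCompactElement_top, finite_iff_isCompactElement_top]
  let i : Subobject P ≃o Subobject (e.functor.obj P) :=
    ((MonoOver.congr P e).trans (ThinSkeleton.equivalence _).symm).thinSkeletonOrderIso
  rw [← i.map_top, isCompactElement_map_iff]

lemma nonempty_equivalence_of_isMoritaEquivalent {A B : Type v} [Ring A] [Ring B]
    [Algebra ℤ A] [Algebra ℤ B]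
    (h : IsMoritaEquivalent ℤ A B) : Nonempty (FGProj A ≌ FGProj B) := by
  obtain ⟨⟨e, _⟩⟩ := h
  let Q : ObjectProperty (ModuleCat.{v} B) := fun P => Module.Finite B P ∧ Module.Projective B P
  have : Q.IsClosedUnderIsomorphisms := ⟨fun e ⟨_, _⟩ =>
    ⟨Module.Finite.equiv e.toLinearEquiv, Module.Projective.of_equiv e.toLinearEquiv⟩⟩
  refine ⟨e.congrFullSubcategory (Q := Q) ?_⟩
  ext P
  refine and_congr (finite_functor_obj_iff e P) ?_
  rw [IsProjective.iff_projective, IsProjective.iff_projective]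
  exact e.map_projective_iff P

end NAb

/-! ### The bijection between equivalence classes -/

namespace NAb

section Equivalence

universe u₁ u₂

variable {C : Type u₁} [Category.{v} C] [Preadditive C] {D : Type u₂} [Category.{v} D]
  [Preadditive D]

lemma IsGeneratedBy.map {X Y : C} (h : IsGeneratedBy X Y) (F : C ⥤ D) [F.Additive] :
    IsGeneratedBy (F.obj X) (F.obj Y) := by
  obtain ⟨k, a, b, hab⟩ := h
  refine ⟨k, fun i => F.map (a i), fun i => F.map (b i), ?_⟩
  simp only [← F.map_comp, ← F.map_sum, hab, F.map_id]

lemma IsGeneratedBy.of_iso {X Y Y' : C} (h : IsGeneratedBy X Y) (i : Y ≅ Y') :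
    IsGeneratedBy X Y' := by
  obtain ⟨k, a, b, hab⟩ := h
  refine ⟨k, fun j => i.inv ≫ a j, fun j => b j ≫ i.hom, ?_⟩
  have : ∑ j, (i.inv ≫ a j) ≫ b j ≫ i.hom = i.inv ≫ (∑ j, a j ≫ b j) ≫ i.hom := by
    simp [Preadditive.sum_comp, Preadditive.comp_sum]
  rw [this, hab]
  simp

/-- A fully faithful additive functor induces isomorphisms of endomorphism rings. -/
noncomputable def endRingEquiv (F : C ⥤ D) [F.Additive] [F.Full] [F.Faithful] (X : C) :
    End X ≃+* End (F.obj X) :=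
  { (Functor.FullyFaithful.ofFullyFaithful F).mulEquivEnd X with
    map_add' := fun _ _ => F.map_add }

/-- Endomorphism rings of additive generators of equivalent categories are Morita equivalent. -/
lemma isMoritaEquivalent_end_of_equivalence (e : C ≌ D) [e.functor.Additive] {X : C} {Y : D}
    [Algebra ℤ (End X)ᵐᵒᵖ] [Algebra ℤ (End Y)ᵐᵒᵖ] (hX : ∀ Z, IsGeneratedBy X Z)
    (hY : ∀ Z, IsGeneratedBy Y Z) :
    IsMoritaEquivalent ℤ (End X)ᵐᵒᵖ (End Y)ᵐᵒᵖ :=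
  (isMoritaEquivalent_of_ringEquiv (RingEquiv.op (endRingEquiv e.functor X))).trans ℤ
    (isMoritaEquivalent_end
      (fun Z => ((hX (e.inverse.obj Z)).map e.functor).of_iso (e.counitIso.app Z)) hY)

lemma IsNAbelian.of_equivalence {n : ℕ} [HasFiniteBiproducts D] [IsIdempotentComplete D]
    (e : C ≌ D) [e.functor.Additive] (h : IsNAbelian n C) : IsNAbelian n D := by
  have : e.op.functor.Additive := (inferInstance : e.functor.op.Additive)
  exact .of_hasNKernelAxioms (h.hasNKernelAxioms.of_equivalence e)
    (h.hasNKernelAxioms_op.of_equivalence e.op)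

end Equivalence

variable {n : ℕ}

lemma IsNAbelian.satisfiesR_end (hn : 1 ≤ n) {C : Type (v + 1)} [Category.{v} C] [Preadditive C]
    (h : IsNAbelian n C) {X : C} (hX : IsAdditiveGenerator X) : SatisfiesR n (End X) := by
  have := h.hasFiniteBiproducts
  have := h.isIdempotentComplete
  have : (homFunctor hX.isGeneratedBy).asEquivalence.functor.Additive :=
    (inferInstance : (homFunctor hX.isGeneratedBy).Additive)
  exact satisfiesR_of_isNAbelian hn
    (h.of_equivalence (homFunctor hX.isGeneratedBy).asEquivalence)

lemma FGProj.isGeneratedBy_self {R : Type v} [Ring R] (P : FGProj R) :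
    IsGeneratedBy (fgp R : FGProj R) P :=
  isGeneratedBy_of_equiv (LinearEquiv.refl R R) P

lemma FGProj.exists_isAdditiveGenerator (R : Type v) [Ring R] :
    ∃ X : FGProj R, IsAdditiveGenerator X :=
  ⟨fgp R, isAdditiveGenerator_of_isGeneratedBy isGeneratedBy_self⟩

/-- Endomorphisms of the regular module are right multiplications. -/
def FGProj.endSelfEquivOp (R : Type v) [Ring R] : End (fgp R : FGProj R) ≃+* Rᵐᵒᵖ :=
  let e : End (fgp R : FGProj R) ≃+* Module.End R R :=
    { toFun := fun f => (show fgp R ⟶ fgp R from f).hom.hom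
      invFun := fun f => fgpHom f
      left_inv := fun _ => rfl
      right_inv := fun _ => rfl
      map_mul' := fun _ _ => rfl
      map_add' := fun _ _ => rfl }
  e.trans (RingEquiv.moduleEndSelf R).symm

/-- The opposite of the endomorphism ring of the regular module. -/
def FGProj.endSelfEquiv (R : Type v) [Ring R] : (End (fgp R : FGProj R))ᵐᵒᵖ ≃+* R :=
  (RingEquiv.op (endSelfEquivOp R)).trans (RingEquiv.opOp R).symm

lemma FGProj.isMoritaEquivalent_end {R : Type v} [Ring R] {X : FGProj R}
    (hX : IsAdditiveGenerator X) {_ : Algebra ℤ (End X)ᵐᵒᵖ} {_ : Algebra ℤ R} :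
    IsMoritaEquivalent ℤ (End X)ᵐᵒᵖ R :=
  (NAb.isMoritaEquivalent_end hX.isGeneratedBy isGeneratedBy_self).trans ℤ
    (isMoritaEquivalent_of_ringEquiv (endSelfEquiv R))

/-- The class of the endomorphism ring of an additive generator. -/
noncomputable def endClass (hn : 1 ≤ n) (C : NAbelianCat.{v} n) : RRing.{v} n :=
  ⟨End C.hasAdditiveGenerator.choose,
    C.isNAbelian.satisfiesR_end hn C.hasAdditiveGenerator.choose_spec⟩

/-- The category of finitely generated projective right modules. -/
def projClass (hn : 1 ≤ n) (Λ : RRing.{v} n) : NAbelianCat.{v} n :=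
  ⟨FGProj Λ.carrierᵐᵒᵖ, Λ.satisfiesR.isNAbelian hn, FGProj.exists_isAdditiveGenerator _⟩

lemma isMoritaEquivalent_end_of_equiv {C D : NAbelianCat.{v} n} (h : C ≈ D) {X : C.carrier}
    {Y : D.carrier} {_ : Algebra ℤ (End X)ᵐᵒᵖ} {_ : Algebra ℤ (End Y)ᵐᵒᵖ}
    (hX : IsAdditiveGenerator X) (hY : IsAdditiveGenerator Y) :
    IsMoritaEquivalent ℤ (End X)ᵐᵒᵖ (End Y)ᵐᵒᵖ := by
  obtain ⟨e⟩ := h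
  have := C.isNAbelian.hasFiniteBiproducts
  have : HasBinaryBiproducts C.carrier := hasBinaryBiproducts_of_finite_biproducts _
  have : e.functor.Additive := e.functor.additive_of_preserves_binary_products
  exact isMoritaEquivalent_end_of_equivalence e hX.isGeneratedBy hY.isGeneratedBy

/-- The correspondence between `n`-abelian categories with additive generators and rings. -/
noncomputable def classesEquiv (hn : 1 ≤ n) : NAbelianClasses.{v} n ≃ MoritaClasses.{v} n where
  toFun := Quotient.map (endClass hn) fun C D h =>
    isMoritaEquivalent_end_of_equiv h C.hasAdditiveGenerator.choose_spec
      D.hasAdditiveGenerator.choose_spec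
  invFun := Quotient.map (projClass hn) fun _ _ h => nonempty_equivalence_of_isMoritaEquivalent h
  left_inv := by
    rintro ⟨C⟩
    have := C.isNAbelian.hasFiniteBiproducts
    have := C.isNAbelian.isIdempotentComplete
    exact Quotient.sound
      ⟨(homFunctor C.hasAdditiveGenerator.choose_spec.isGeneratedBy).asEquivalence.symm⟩
  right_inv := by
    rintro ⟨Λ⟩
    refine Quotient.sound (a := endClass hn (projClass hn Λ)) (b := Λ) ?_
    exact FGProj.isMoritaEquivalent_end (projClass hn Λ).hasAdditiveGenerator.choose_spec

end NAb

theorem theorem6 (n : ℕ) (hn : 1 ≤ n) :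
    ∃ (hEnd : ∀ (C : Type (v + 1)) [Category.{v} C] [Preadditive C],
        NAb.IsNAbelian n C → ∀ X : C, NAb.IsAdditiveGenerator X → NAb.SatisfiesR n (End X))
      (hProj : ∀ (Λ : Type v) [Ring Λ], NAb.SatisfiesR n Λ →
        NAb.IsNAbelian n (NAb.FGProj Λᵐᵒᵖ) ∧
          ∃ X : NAb.FGProj Λᵐᵒᵖ, NAb.IsAdditiveGenerator X)
      (e : NAb.NAbelianClasses.{v} n ≃ NAb.MoritaClasses.{v} n),
      (∀ (C : NAb.NAbelianCat.{v} n) (X : C.carrier) (hX : NAb.IsAdditiveGenerator X),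
        e ⟦C⟧ = ⟦⟨End X, hEnd C.carrier C.isNAbelian X hX⟩⟧) ∧
      (∀ Λ : NAb.RRing.{v} n,
        e.symm ⟦Λ⟧ = ⟦⟨NAb.FGProj Λ.carrierᵐᵒᵖ, (hProj Λ.carrier Λ.satisfiesR).1,
          (hProj Λ.carrier Λ.satisfiesR).2⟩⟧) :=
  ⟨fun _ _ _ h _ hX => h.satisfiesR_end hn hX,
    fun _ _ h => ⟨h.isNAbelian hn, NAb.FGProj.exists_isAdditiveGenerator _⟩,
    NAb.classesEquiv hn,
    fun C _ hX => Quotient.sound (NAb.isMoritaEquivalent_end_of_equiv (Setoid.refl C)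
      C.hasAdditiveGenerator.choose_spec hX),
    fun _ => rfl⟩
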